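/- Let $G$ be a second countable, locally compact Hausdorff étale groupoid with unit space $G^{(0)}$ and range and source maps $r,s$; write $G^{u}=r^{-1}(u)$ and $G_u=s^{-1}(u)$. Let $p\colon \mathscr B\to G$ be a saturated Fell bundle over $G$: an upper semicontinuous Banach bundle with fibres $B_\gamma=p^{-1}(\gamma)$, a continuous, bilinear, associative multiplication $B_\gamma\times B_\eta\to B_{\gamma\eta}$ (for composable $\gamma,\eta$) and a continuous conjugate-linear involution $B_\gamma\to B_{\gamma^{-1}}$ with $(b^*)^*=b$, $(ab)^*=b^*a^*$, $\|ab\|\le\|a\|\|b\|$, $\|b^*b\|=\|b\|^2$ and $b^*b\ge 0$ in the $C^*$-algebra $A_{s(\gamma)}:=B_{s(\gamma)}$ for $b\in B_\gamma$, such that $\operatorname{span}B_\gamma B_\eta$ is dense in $B_{\gamma\eta}$ for all composable $\gamma,\eta$ (so every $B_\gamma$ is a $B_{r(\gamma)}$–$B_{s(\gamma)}$-imprimitivity bimodule). Suppose that $\mathscr B$ is separable, i.e. that the Banach space $\Gamma_0(G;\mathscr B)$ of continuous sections vanishing at infinity, with the supremum norm, is separable. Let $\Gamma_c(G;\mathscr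 B)$ be the $*$-algebra of continuous compactly supported sections, with $(f*g)(\gamma)=\sum_{\eta\in G^{r(\gamma)}}f(\eta)g(\eta^{-1}\gamma)$ and $f^*(\gamma)=f(\gamma^{-1})^*$. For $u\in G^{(0)}$ let $\mathsf X_u$ be the right Hilbert $A_u$-module completion of the finitely supported functions $h$ on $G_u$ with $h(\eta)\in B_\eta$, for the inner product $\langle h,k\rangle=\sum_{\eta\in G_u}h(\eta)^*k(\eta)$, let $V_u(f)$ be the operator $(V_u(f)h)(\zeta)=\sum_{\eta\in G^{r(\zeta)}}f(\eta)h(\eta^{-1}\zeta)$ on $\mathsf X_u$, let $\|f\|_r=\sup_{u\in G^{(0)}}\|V_u(f)\|$ be the reduced norm, and let $C^*_r(G;\mathscr B)$ be the completion of $\Gamma_c(G;\mathscr B)$ in $\|\cdot\|_r$, a $C^*$-algebra. Then there is an injective linear map $j\colon C^*_r(G;\mathscr B)\to\Gamma_0(G;\mathscr B)$ such that $\|j(a)\|_\infty\le\|a\|_r$ for all $a\in C^*_r(G;\mathscr B)$ and $j(f)(\gamma)=f(\gamma)$ for all $f\in\Gamma_c(G;\mathscr B)$ and $\gamma\in G$.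 Moreover, for all $a,b\in C^*_r(G;\mathscr B)$ and $\gamma\in G$, $$j(a^*)(\gamma)=j(a)(\gamma^{-1})^*\qquad\text{and}\qquad j(a*b)(\gamma)=\sum_{\eta\in G^{r(\gamma)}}j(a)(\eta)\,j(b)(\eta^{-1}\gamma),$$ where the sum converges in the norm of $B_\gamma$ as the limit of the net of its finite partial sums, indexed by the finite subsets of $G^{r(\gamma)}$ ordered by inclusion. -/

import Mathlib

namespace Fell

noncomputable section

open scoped Topology
open Filter Bundle

set_option linter.unusedSectionVars false

universe u v

/-- A groupoid, presented by its set `G` of arrows: range and source maps with values in the units,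
inversion, and a multiplication which is only meaningful (and only used) on composable pairs,
i.e. on pairs `(γ, η)` with `s γ = r η`. -/
class ArrowGroupoid (G : Type u) extends Mul G, Inv G where
  r : G → G
  s : G → G
  r_r (γ : G) : r (r γ) = r γ
  s_r (γ : G) : s (r γ) = r γ
  r_s (γ : G) : r (s γ) = s γ
  s_s (γ : G) : s (s γ) = s γ
  r_inv (γ : G) : r γ⁻¹ = s γ
  s_inv (γ : G) : s γ⁻¹ = r γ
  r_mul {γ η : G} (h : s γ = r η) : r (γ * η) = r γ
  s_mul {γ η : G} (h : s γ = r η) : s (γ * η) = s η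
  assoc {γ η ζ : G} (h₁ : s γ = r η) (h₂ : s η = r ζ) : γ * η * ζ = γ * (η * ζ)
  range_mul (γ : G) : r γ * γ = γ
  mul_source (γ : G) : γ * s γ = γ
  self_mul_inv (γ : G) : γ * γ⁻¹ = r γ
  inv_mul_self (γ : G) : γ⁻¹ * γ = s γ

open ArrowGroupoid

section Groupoid

variable {G : Type u} [ArrowGroupoid G]

/-- `IsProd γ η ζ`: the pair `(γ, η)` is composable and its product is `ζ`. -/
def IsProd (γ η ζ : G) : Prop := s γ = r η ∧ γ * η = ζ

variable (G) in
/-- The unit space `G⁽⁰⁾`. -/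
abbrev Units : Type u := {u : G // r u = u}

/-- The range map, as a map onto the unit space. -/
def rangeUnit (γ : G) : Units G := ⟨r γ, r_r γ⟩

theorem inv_inv' (γ : G) : γ⁻¹⁻¹ = γ := by
  have h1 : γ⁻¹⁻¹ * (γ⁻¹ * γ) = γ⁻¹⁻¹ * γ⁻¹ * γ := (assoc (s_inv _) (s_inv _)).symm
  rw [inv_mul_self, inv_mul_self, s_inv, range_mul] at h1
  have h2 := mul_source γ⁻¹⁻¹
  rw [s_inv, r_inv] at h2
  rw [← h2, h1]

theorem s_unit (u : Units G) : s u.1 = u.1 := by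
  conv_lhs => rw [← u.2]
  rw [s_r, u.2]

theorem inv_mul_cancel_left' {γ η : G} (h : s γ = r η) : γ⁻¹ * (γ * η) = η := by
  rw [← assoc (s_inv _) h, inv_mul_self, h, range_mul]

theorem mul_inv_cancel_left' {γ η : G} (h : r γ = r η) : γ * (γ⁻¹ * η) = η := by
  rw [← assoc (r_inv _).symm (by rw [s_inv, h]), self_mul_inv, h, range_mul]

theorem mul_inv_cancel_right' {γ η : G} (h : s γ = r η) : γ * η * η⁻¹ = γ := by
  rw [assoc h (r_inv _).symm, self_mul_inv, ← h, mul_source]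

theorem inv_mul_cancel_right' {γ η : G} (h : s γ = s η) : γ * η⁻¹ * η = γ := by
  rw [assoc (by rw [r_inv, h]) (s_inv _), inv_mul_self, ← h, mul_source]

theorem eq_inv_mul {γ η ζ : G} (h : IsProd γ η ζ) : γ⁻¹ * ζ = η := by
  obtain ⟨h, rfl⟩ := h; exact inv_mul_cancel_left' h

theorem eq_mul_inv {γ η ζ : G} (h : IsProd γ η ζ) : ζ * η⁻¹ = γ := by
  obtain ⟨h, rfl⟩ := h; exact mul_inv_cancel_right' h

theorem IsProd.r_eq {γ η ζ : G} (h : IsProd γ η ζ) : r ζ = r γ := by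
  obtain ⟨h, rfl⟩ := h; exact r_mul h

theorem IsProd.s_eq {γ η ζ : G} (h : IsProd γ η ζ) : s ζ = s η := by
  obtain ⟨h, rfl⟩ := h; exact s_mul h

/-- `η · (η⁻¹γ) = γ` when `r η = r γ`. -/
theorem isProd_left {η γ : G} (h : r η = r γ) : IsProd η (η⁻¹ * γ) γ :=
  ⟨by rw [r_mul (by rw [s_inv, h]), r_inv], mul_inv_cancel_left' h⟩

/-- `(γη⁻¹) · η = γ` when `s γ = s η`. -/
theorem isProd_right {γ η : G} (h : s γ = s η) : IsProd (γ * η⁻¹) η γ :=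
  ⟨by rw [s_mul (by rw [r_inv, h]), s_inv], inv_mul_cancel_right' h⟩

/-- `η⁻¹ · η = u` when `s η = u`. -/
theorem isProd_inv {η u : G} (h : s η = u) : IsProd η⁻¹ η u :=
  ⟨s_inv η, by rw [inv_mul_self, h]⟩

theorem isProd_unit (u : Units G) : IsProd u.1 u.1 u.1 :=
  ⟨by rw [s_unit, u.2], by conv_lhs => rw [← u.2]
                           rw [u.2]; conv_lhs => enter [1]; rw [← u.2]
                           rw [range_mul]⟩

theorem isProd_source {γ u : G} (h : s γ = u) : IsProd γ u γ :=
  ⟨by rw [← h, r_s], by rw [← h, mul_source]⟩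

theorem inv_unit (u : Units G) : u.1⁻¹ = u.1 := by
  have := mul_source (u.1⁻¹)
  rw [s_inv, u.2] at this
  rw [← this, inv_mul_self, s_unit]

theorem IsProd.inv {γ η ζ : G} (h : IsProd γ η ζ) : IsProd η⁻¹ γ⁻¹ ζ⁻¹ := by
  have h0 : s η⁻¹ = r γ⁻¹ := by rw [s_inv, r_inv, h.1]
  refine ⟨h0, ?_⟩
  have h1 : IsProd ζ⁻¹ γ η⁻¹ := by
    have e := eq_inv_mul h
    have hr := h.r_eq
    have h2 : IsProd γ⁻¹ ζ η := ⟨by rw [s_inv, hr], e⟩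
    have h3 := eq_mul_inv h2
    refine ⟨by rw [s_inv, hr], ?_⟩
    have h4 : IsProd η ζ⁻¹ γ⁻¹ := ⟨by rw [r_inv, h.s_eq], h3⟩
    have h5 := eq_inv_mul h4
    rw [← h5, assoc (by rw [s_inv, r_inv, h.1]) (s_inv _), inv_mul_self, h.1, ← s_inv, mul_source]
  rw [← eq_mul_inv h1]

/-- Étale groupoids: multiplication (on composable pairs) and inversion are continuous, and the
range map onto the unit space is a local homeomorphism. -/
class IsEtale (G : Type u) [TopologicalSpace G] [ArrowGroupoid G] : Prop where
  continuousOn_mul : ContinuousOn (fun q : G × G => q.1 * q.2) {q | s q.1 = r q.2}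
  continuous_inv : Continuous (fun γ : G => γ⁻¹)
  isLocalHomeomorph_range : IsLocalHomeomorph (rangeUnit : G → Units G)

end Groupoid

section Bundles

/-- An (upper semicontinuous) Banach bundle over `X`: each fibre `B x` is a complex Banach space,
the total space carries a topology for which the projection is continuous and open, the norm is
upper semicontinuous, addition (on the fibre product) and scalar multiplication are continuous, and
`bᵢ → 0ₓ` whenever `p bᵢ → x` and `‖bᵢ‖ → 0`. -/
class IsBanachBundle {X : Type u} [TopologicalSpace X] (B : X → Type v)
    [∀ x, NormedAddCommGroup (B x)] [∀ x, NormedSpace ℂ (B x)]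
    [TopologicalSpace (TotalSpace Unit B)] : Prop where
  completeSpace (x : X) : CompleteSpace (B x)
  continuous_proj : Continuous (TotalSpace.proj : TotalSpace Unit B → X)
  isOpenMap_proj : IsOpenMap (TotalSpace.proj : TotalSpace Unit B → X)
  upperSemicontinuous_norm : UpperSemicontinuous (fun b : TotalSpace Unit B => ‖b.snd‖)
  continuous_add : Continuous[TopologicalSpace.induced
      (fun q : (Σ x, B x × B x) =>
        ((⟨q.1, q.2.1⟩, ⟨q.1, q.2.2⟩) : TotalSpace Unit B × TotalSpace Unit B)) inferInstance,
      inferInstance]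
    (fun q : (Σ x, B x × B x) => (⟨q.1, q.2.1 + q.2.2⟩ : TotalSpace Unit B))
  continuous_smul (c : ℂ) :
    Continuous (fun b : TotalSpace Unit B => (⟨b.proj, c • b.snd⟩ : TotalSpace Unit B))
  tendsto_zero (x : X) :
    comap (TotalSpace.proj : TotalSpace Unit B → X) (𝓝 x) ⊓
      comap (fun b : TotalSpace Unit B => ‖b.snd‖) (𝓝 0) ≤ 𝓝 (⟨x, 0⟩ : TotalSpace Unit B)

variable {G : Type u} [TopologicalSpace G] [ArrowGroupoid G]

/-- A Fell bundle over the groupoid `G`. The product `B γ × B η → B ζ` is given for every triple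
with `γη = ζ`, the involution `B γ → B δ` for `δ = γ⁻¹`; being indexed by propositions, these are
just the maps `B γ × B η → B (γη)` and `B γ → B (γ⁻¹)`. The product is bilinear, associative,
submultiplicative and continuous on composable pairs, the involution is conjugate linear,
involutive, antimultiplicative and continuous; moreover `‖a* a‖ = ‖a‖²` and `a* a` is a positive
element `c* c` of the C*-algebra `B (s γ)`. -/
class FellBundle (B : G → Type v)
    [∀ γ, NormedAddCommGroup (B γ)] [∀ γ, NormedSpace ℂ (B γ)]
    [TopologicalSpace (TotalSpace Unit B)] extends IsBanachBundle B where
  mul {γ η ζ : G} (h : IsProd γ η ζ) : B γ → B η → B ζ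
  adj {γ δ : G} (h : δ = γ⁻¹) : B γ → B δ
  mul_add {γ η ζ : G} (h : IsProd γ η ζ) (a : B γ) (b c : B η) :
    mul h a (b + c) = mul h a b + mul h a c
  add_mul {γ η ζ : G} (h : IsProd γ η ζ) (a b : B γ) (c : B η) :
    mul h (a + b) c = mul h a c + mul h b c
  mul_smul {γ η ζ : G} (h : IsProd γ η ζ) (z : ℂ) (a : B γ) (b : B η) :
    mul h a (z • b) = z • mul h a b
  smul_mul {γ η ζ : G} (h : IsProd γ η ζ) (z : ℂ) (a : B γ) (b : B η) :
    mul h (z • a) b = z • mul h a b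
  mul_assoc {γ η ζ γη ηζ δ : G} (h₁ : IsProd γ η γη) (h₂ : IsProd γη ζ δ)
    (h₃ : IsProd η ζ ηζ) (h₄ : IsProd γ ηζ δ) (a : B γ) (b : B η) (c : B ζ) :
    mul h₂ (mul h₁ a b) c = mul h₄ a (mul h₃ b c)
  adj_add {γ δ : G} (h : δ = γ⁻¹) (a b : B γ) : adj h (a + b) = adj h a + adj h b
  adj_smul {γ δ : G} (h : δ = γ⁻¹) (z : ℂ) (a : B γ) : adj h (z • a) = star z • adj h a
  adj_adj {γ δ : G} (h : δ = γ⁻¹) (h' : γ = δ⁻¹) (a : B γ) : adj h' (adj h a) = a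
  adj_mul {γ η ζ γ' η' ζ' : G} (h : IsProd γ η ζ) (h' : IsProd η' γ' ζ') (hγ : γ' = γ⁻¹)
    (hη : η' = η⁻¹) (hζ : ζ' = ζ⁻¹) (a : B γ) (b : B η) :
    adj hζ (mul h a b) = mul h' (adj hη b) (adj hγ a)
  norm_mul_le {γ η ζ : G} (h : IsProd γ η ζ) (a : B γ) (b : B η) : ‖mul h a b‖ ≤ ‖a‖ * ‖b‖
  norm_adj_mul_self {γ u : G} (h : IsProd γ⁻¹ γ u) (a : B γ) :
    ‖mul h (adj rfl a) a‖ = ‖a‖ ^ 2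
  adj_mul_self_nonneg {γ u : G} (h : IsProd γ⁻¹ γ u) (hu : IsProd u⁻¹ u u) (a : B γ) :
    ∃ c : B u, mul h (adj rfl a) a = mul hu (adj rfl c) c
  continuous_mul : Continuous
    (fun q : {q : TotalSpace Unit B × TotalSpace Unit B // s q.1.proj = r q.2.proj} =>
      (⟨q.1.1.proj * q.1.2.proj, mul ⟨q.2, rfl⟩ q.1.1.snd q.1.2.snd⟩ : TotalSpace Unit B))
  continuous_adj : Continuous
    (fun b : TotalSpace Unit B => (⟨b.proj⁻¹, adj rfl b.snd⟩ : TotalSpace Unit B))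

/-- A Fell bundle is saturated if `span (B γ · B η)` is dense in `B (γη)` for all composable
`γ, η`. Together with the axioms above this makes every fibre `B γ` a
`B (r γ)`-`B (s γ)`-imprimitivity bimodule. -/
def IsSaturated (B : G → Type v)
    [∀ γ, NormedAddCommGroup (B γ)] [∀ γ, NormedSpace ℂ (B γ)]
    [TopologicalSpace (TotalSpace Unit B)] [FellBundle B] : Prop :=
  ∀ (γ η ζ : G) (h : IsProd γ η ζ),
    Dense (Submodule.span ℂ {c : B ζ | ∃ (a : B γ) (b : B η), c = FellBundle.mul h a b} : Set (B ζ))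

end Bundles

section Sections

variable {X : Type u} [TopologicalSpace X] (B : X → Type v)
  [∀ x, NormedAddCommGroup (B x)] [∀ x, NormedSpace ℂ (B x)]
  [TopologicalSpace (TotalSpace Unit B)]

variable {B} in
/-- A section `f` regarded as a map into the total space. -/
def toTotal (f : ∀ x, B x) (x : X) : TotalSpace Unit B := ⟨x, f x⟩

variable [IsBanachBundle B]

variable {B}

theorem continuousAt_add_section {f g : ∀ x, B x} {x : X} (hf : ContinuousAt (toTotal f) x)
    (hg : ContinuousAt (toTotal g) x) : ContinuousAt (toTotal (f + g)) x := by
  let t : TopologicalSpace (Σ x, B x × B x) := TopologicalSpace.induced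
      (fun q : (Σ x, B x × B x) =>
        ((⟨q.1, q.2.1⟩, ⟨q.1, q.2.2⟩) : TotalSpace Unit B × TotalSpace Unit B)) inferInstance
  have h1 : ContinuousAt (fun x => (⟨x, (f x, g x)⟩ : Σ x, B x × B x)) x := by
    rw [ContinuousAt, nhds_induced, tendsto_comap_iff]
    exact hf.prodMk hg
  exact (IsBanachBundle.continuous_add (B := B)).continuousAt.comp h1

theorem continuousAt_smul_section (c : ℂ) {f : ∀ x, B x} {x : X}
    (hf : ContinuousAt (toTotal f) x) : ContinuousAt (toTotal (c • f)) x :=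
  (IsBanachBundle.continuous_smul (B := B) c).continuousAt.comp hf

theorem continuous_zero_section : Continuous (toTotal (0 : ∀ x, B x)) := by
  rw [continuous_iff_continuousAt]
  intro x
  refine le_trans ?_ (IsBanachBundle.tendsto_zero (B := B) x)
  refine le_inf ?_ ?_
  · rw [← tendsto_iff_comap, tendsto_map'_iff]
    exact tendsto_id
  · rw [← tendsto_iff_comap, tendsto_map'_iff]
    have : (fun b : TotalSpace Unit B => ‖b.snd‖) ∘ toTotal (0 : ∀ x, B x) = fun _ => 0 :=
      funext fun y => norm_zero
    rw [this]
    exact tendsto_const_nhds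

theorem continuousAt_sum_section {ι : Type*} (F : Finset ι) (f : ι → ∀ x, B x) {x : X}
    (hf : ∀ i ∈ F, ContinuousAt (toTotal (f i)) x) :
    ContinuousAt (toTotal (∑ i ∈ F, f i)) x := by
  classical
  induction F using Finset.induction_on with
  | empty => simpa using continuous_zero_section.continuousAt
  | insert i F hi ih =>
    rw [Finset.sum_insert hi]
    exact continuousAt_add_section (hf i (by simp)) (ih fun j hj => hf j (by simp [hj]))

theorem upperSemicontinuous_norm_section {f : ∀ x, B x} (hf : Continuous (toTotal f)) :
    UpperSemicontinuous (fun x => ‖f x‖) :=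
  (IsBanachBundle.upperSemicontinuous_norm (B := B)).comp hf

variable (B)

/-- `Γ₀(X; B)`: the Banach space of continuous sections vanishing at infinity, with the supremum
norm, as a subspace of the space of all bounded sections. -/
def C0Section : Submodule ℂ (lp B ⊤) where
  carrier := {f | Continuous (toTotal (f : ∀ x, B x)) ∧
    Tendsto (fun x => ‖(f : ∀ x, B x) x‖) (cocompact X) (𝓝 0)}
  add_mem' {f g} hf hg := by
    refine ⟨continuous_iff_continuousAt.2 fun x =>
      continuousAt_add_section hf.1.continuousAt hg.1.continuousAt, ?_⟩
    refine squeeze_zero (fun _ => norm_nonneg _) (fun x => norm_add_le _ _) ?_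
    simpa using hf.2.add hg.2
  zero_mem' := ⟨continuous_zero_section, by simpa using tendsto_const_nhds⟩
  smul_mem' c f hf := by
    refine ⟨continuous_iff_continuousAt.2 fun x =>
      continuousAt_smul_section c hf.1.continuousAt, ?_⟩
    simpa [norm_smul] using hf.2.const_mul ‖c‖

variable {B} in
/-- Boundedness is automatic for continuous sections vanishing at infinity. -/
theorem memℓp_of_vanishing {f : ∀ x, B x} (hf : Continuous (toTotal f))
    (h0 : Tendsto (fun x => ‖f x‖) (cocompact X) (𝓝 0)) : Memℓp f ⊤ := by
  have h1 : ∀ᶠ x in cocompact X, ‖f x‖ < 1 := h0.eventually_lt_const one_pos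
  obtain ⟨K, hK, hKf⟩ := mem_cocompact.1 h1
  obtain ⟨C, hC⟩ := (upperSemicontinuous_norm_section hf).upperSemicontinuousOn K
    |>.bddAbove_of_isCompact hK
  refine memℓp_infty ⟨max C 1, ?_⟩
  rintro _ ⟨x, rfl⟩
  by_cases hx : x ∈ K
  · exact le_max_of_le_left (hC ⟨x, hx, rfl⟩)
  · exact le_max_of_le_right (le_of_lt (hKf hx))

/-- The value at `x` of `f ∈ Γ₀(X; B)`. -/
instance : CoeFun (C0Section B) (fun _ => ∀ x, B x) := ⟨fun f => (f.1 : ∀ x, B x)⟩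

/-- The vector space of continuous sections with compact support. -/
def ccSubmodule : Submodule ℂ (∀ x, B x) where
  carrier := {f | Continuous (toTotal f) ∧ ∃ K : Set X, IsCompact K ∧ ∀ x ∉ K, f x = 0}
  add_mem' := by
    rintro f g ⟨hf, K, hK, hfK⟩ ⟨hg, L, hL, hgL⟩
    refine ⟨continuous_iff_continuousAt.2 fun x =>
      continuousAt_add_section hf.continuousAt hg.continuousAt, K ∪ L, hK.union hL, ?_⟩
    intro x hx
    rw [Set.mem_union, not_or] at hx
    simp [hfK x hx.1, hgL x hx.2]
  zero_mem' := ⟨continuous_zero_section, ∅, isCompact_empty, by simp⟩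
  smul_mem' := by
    rintro c f ⟨hf, K, hK, hfK⟩
    refine ⟨continuous_iff_continuousAt.2 fun x =>
      continuousAt_smul_section c hf.continuousAt, K, hK, ?_⟩
    intro x hx
    simp [hfK x hx]

/-- `Γ_c(X; B)`: continuous sections with compact support. -/
def CcSection : Type max u v := ccSubmodule B

instance : AddCommGroup (CcSection B) := inferInstanceAs (AddCommGroup (ccSubmodule B))
instance : Module ℂ (CcSection B) := inferInstanceAs (Module ℂ (ccSubmodule B))

variable {B}

/-- The underlying section. -/
def CcSection.toFun (f : CcSection B) : ∀ x, B x := Subtype.val (p := (· ∈ ccSubmodule B)) f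

instance : CoeFun (CcSection B) (fun _ => ∀ x, B x) := ⟨CcSection.toFun⟩

/-- A compactly supported continuous section as an element of `Γ_c(X; B)`. -/
def CcSection.mk (f : ∀ x, B x) (hf : Continuous (toTotal f))
    (hK : ∃ K : Set X, IsCompact K ∧ ∀ x ∉ K, f x = 0) : CcSection B :=
  Subtype.mk (p := (· ∈ ccSubmodule B)) f ⟨hf, hK⟩

@[simp] theorem CcSection.mk_apply (f : ∀ x, B x) (hf hK) (x : X) :
    CcSection.mk f hf hK x = f x := rfl

theorem CcSection.continuous (f : CcSection B) : Continuous (toTotal f) :=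
  (Subtype.prop (p := (· ∈ ccSubmodule B)) f).1

theorem CcSection.exists_compact (f : CcSection B) :
    ∃ K : Set X, IsCompact K ∧ ∀ x ∉ K, f x = 0 :=
  (Subtype.prop (p := (· ∈ ccSubmodule B)) f).2

@[ext] theorem CcSection.ext {f g : CcSection B} (h : ∀ x, f x = g x) : f = g :=
  Subtype.ext (funext h)

@[simp] theorem CcSection.add_apply (f g : CcSection B) (x : X) : (f + g) x = f x + g x := rfl
@[simp] theorem CcSection.smul_apply (c : ℂ) (f : CcSection B) (x : X) : (c • f) x = c • f x := rfl
@[simp] theorem CcSection.zero_apply (x : X) : (0 : CcSection B) x = 0 := rfl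

theorem CcSection.bounded (f : CcSection B) : ∃ C, 0 ≤ C ∧ ∀ x, ‖f x‖ ≤ C := by
  obtain ⟨K, hK, hf⟩ := f.exists_compact
  obtain ⟨C, hC⟩ := (upperSemicontinuous_norm_section f.continuous).upperSemicontinuousOn K
    |>.bddAbove_of_isCompact hK
  refine ⟨max C 0, le_max_right _ _, fun x => ?_⟩
  by_cases hx : x ∈ K
  · exact le_max_of_le_left (hC ⟨x, hx, rfl⟩)
  · simp [hf x hx]

end Sections

section Convolution

variable {G : Type u} [ArrowGroupoid G] [TopologicalSpace G]
variable {B : G → Type v} [∀ γ, NormedAddCommGroup (B γ)] [∀ γ, NormedSpace ℂ (B γ)]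
  [TopologicalSpace (TotalSpace Unit B)] [FellBundle B]

namespace FellBundle

/-- The product of a Fell bundle as a bilinear map. -/
def mulₗ {γ η ζ : G} (h : IsProd γ η ζ) : B γ →ₗ[ℂ] B η →ₗ[ℂ] B ζ :=
  LinearMap.mk₂ ℂ (mul h) (fun a b c => add_mul h a b c) (fun z a b => smul_mul h z a b)
    (fun a b c => mul_add h a b c) (fun z a b => mul_smul h z a b)

theorem mulₗ_apply {γ η ζ : G} (h : IsProd γ η ζ) (a : B γ) (b : B η) :
    mulₗ h a b = mul h a b := rfl

@[simp] theorem mul_zero {γ η ζ : G} (h : IsProd γ η ζ) (a : B γ) : mul h a (0 : B η) = 0 :=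
  map_zero (mulₗ h a)

@[simp] theorem zero_mul {γ η ζ : G} (h : IsProd γ η ζ) (b : B η) : mul h (0 : B γ) b = 0 := by
  rw [← mulₗ_apply, map_zero, LinearMap.zero_apply]

theorem mul_of_left_eq_zero {γ η ζ : G} (h : IsProd γ η ζ) {a : B γ} (ha : a = 0) (b : B η) :
    mul h a b = 0 := by rw [ha, zero_mul]

theorem mul_sum {ι : Type*} (S : Finset ι) {γ η ζ : G} (h : IsProd γ η ζ) (a : B γ)
    (b : ι → B η) : mul h a (∑ i ∈ S, b i) = ∑ i ∈ S, mul h a (b i) :=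
  map_sum (mulₗ h a) _ _

theorem sum_mul {ι : Type*} (S : Finset ι) {γ η ζ : G} (h : IsProd γ η ζ) (a : ι → B γ)
    (b : B η) : mul h (∑ i ∈ S, a i) b = ∑ i ∈ S, mul h (a i) b := by
  simp only [← mulₗ_apply, map_sum, LinearMap.sum_apply]

@[simp] theorem adj_zero {γ δ : G} (h : δ = γ⁻¹) : adj h (0 : B γ) = 0 := by
  have := adj_smul h 0 (0 : B γ)
  simpa using this

theorem adj_sum {ι : Type*} (S : Finset ι) {γ δ : G} (h : δ = γ⁻¹) (a : ι → B γ) :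
    adj h (∑ i ∈ S, a i) = ∑ i ∈ S, adj h (a i) := by
  classical
  induction S using Finset.induction_on with
  | empty => simp
  | insert i S hi ih => rw [Finset.sum_insert hi, Finset.sum_insert hi, adj_add, ih]

theorem norm_adj_mul_self' {γ γ' u : G} (hγ : γ' = γ⁻¹) (h : IsProd γ' γ u) (a : B γ) :
    ‖mul h (adj hγ a) a‖ = ‖a‖ ^ 2 := by
  subst hγ; exact norm_adj_mul_self h a

theorem norm_le_norm_adj {γ δ : G} (h : δ = γ⁻¹) (a : B γ) : ‖a‖ ≤ ‖adj h a‖ := by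
  subst h
  have h1 := norm_adj_mul_self (isProd_inv rfl) a
  have h2 := norm_mul_le (isProd_inv rfl) (adj rfl a) a
  rw [h1, sq] at h2
  rcases eq_or_ne a 0 with rfl | ha
  · simp
  · exact le_of_mul_le_mul_right h2 (norm_pos_iff.2 ha)

theorem norm_adj {γ δ : G} (h : δ = γ⁻¹) (a : B γ) : ‖adj h a‖ = ‖a‖ := by
  refine le_antisymm ?_ (norm_le_norm_adj h a)
  have h' : γ = δ⁻¹ := by rw [h, inv_inv']
  have := norm_le_norm_adj h' (adj h a)
  rwa [adj_adj h h'] at this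

theorem mul_congr_left {ι : Type*} {g : ι → G} (f : ∀ i, B (g i)) {η ζ : G} {i j : ι} (e : i = j)
    (h : IsProd (g i) η ζ) (h' : IsProd (g j) η ζ) (b : B η) :
    mul h (f i) b = mul h' (f j) b := by
  subst e; rfl

theorem mul_congr_right {ι : Type*} {g : ι → G} (f : ∀ i, B (g i)) {η ζ : G} {i j : ι} (e : i = j)
    (h : IsProd η (g i) ζ) (h' : IsProd η (g j) ζ) (b : B η) :
    mul h b (f i) = mul h' b (f j) := by
  subst e; rfl

end FellBundle

open FellBundle

/-- The convolution `(f * g)(γ) = ∑_{η ∈ G^{r(γ)}} f(η) g(η⁻¹γ)`, a finite sum if `f` has compact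
support. -/
def convFun (f g : ∀ γ, B γ) (γ : G) : B γ :=
  ∑ᶠ η : {η : G // r η = r γ}, mul (isProd_left η.2) (f η.1) (g (η.1⁻¹ * γ))

/-- The involution `f*(γ) = f(γ⁻¹)*`. -/
def starFun (f : ∀ γ, B γ) (γ : G) : B γ := adj (inv_inv' γ).symm (f γ⁻¹)

end Convolution

section EtaleLemmas

variable {G : Type u} [ArrowGroupoid G] [TopologicalSpace G] [IsEtale G]

theorem continuous_r : Continuous (r : G → G) :=
  continuous_subtype_val.comp (IsEtale.isLocalHomeomorph_range (G := G)).continuous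

theorem continuous_s : Continuous (s : G → G) := by
  have : (s : G → G) = fun γ => r γ⁻¹ := funext fun γ => (r_inv γ).symm
  rw [this]
  exact continuous_r.comp IsEtale.continuous_inv

/-- A compact set meets the fibres of the range map in uniformly finitely many points. -/
theorem exists_bound_fibre_r {K : Set G} (hK : IsCompact K) :
    ∃ N : ℕ, ∀ (x : G) (F : Finset G), (∀ γ ∈ F, γ ∈ K ∧ r γ = x) → F.card ≤ N := by
  classical
  have hloc : ∀ γ : G, ∃ U : Set G, IsOpen U ∧ γ ∈ U ∧ Set.InjOn (r : G → G) U := by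
    intro γ
    obtain ⟨e, he, hr⟩ := IsEtale.isLocalHomeomorph_range (G := G) γ
    refine ⟨e.source, e.open_source, he, fun a ha b hb hab => e.injOn ha hb ?_⟩
    rw [← hr]
    exact Subtype.ext hab
  choose U hU hmem hinj using hloc
  obtain ⟨t, ht⟩ := hK.elim_finite_subcover U hU (fun γ _ => Set.mem_iUnion.2 ⟨γ, hmem γ⟩)
  refine ⟨t.card, fun x F hF => ?_⟩
  have hex : ∀ γ ∈ F, ∃ i ∈ t, γ ∈ U i := fun γ hγ => by
    simpa using ht (hF γ hγ).1
  choose! φ hφ hφU using hex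
  refine Finset.card_le_card_of_injOn φ hφ fun a ha b hb hab => ?_
  exact hinj (φ a) (hφU a ha) (by rw [hab]; exact hφU b hb)
    ((hF a ha).2.trans (hF b hb).2.symm)

theorem finite_fibre_r {K : Set G} (hK : IsCompact K) (x : G) : {γ | γ ∈ K ∧ r γ = x}.Finite := by
  obtain ⟨N, hN⟩ := exists_bound_fibre_r hK
  by_contra h
  obtain ⟨F, hF, hc⟩ := Set.Infinite.exists_subset_card_eq h (N + 1)
  have := hN x F (fun γ hγ => hF hγ)
  omega

theorem exists_bound_fibre_s {K : Set G} (hK : IsCompact K) :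
    ∃ N : ℕ, ∀ (x : G) (F : Finset G), (∀ γ ∈ F, γ ∈ K ∧ s γ = x) → F.card ≤ N := by
  classical
  obtain ⟨N, hN⟩ := exists_bound_fibre_r (hK.image (IsEtale.continuous_inv (G := G)))
  refine ⟨N, fun x F hF => ?_⟩
  have hi : Function.Injective (fun γ : G => γ⁻¹) := fun a b hab => by
    rw [← inv_inv' a, ← inv_inv' b]; exact congrArg _ hab
  rw [← Finset.card_image_of_injective F hi]
  refine hN x _ fun γ hγ => ?_
  obtain ⟨δ, hδ, rfl⟩ := Finset.mem_image.1 hγ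
  exact ⟨⟨δ, (hF δ hδ).1, rfl⟩, by rw [r_inv, (hF δ hδ).2]⟩

theorem finite_fibre_s {K : Set G} (hK : IsCompact K) (x : G) : {γ | γ ∈ K ∧ s γ = x}.Finite := by
  obtain ⟨N, hN⟩ := exists_bound_fibre_s hK
  by_contra h
  obtain ⟨F, hF, hc⟩ := Set.Infinite.exists_subset_card_eq h (N + 1)
  have := hN x F (fun γ hγ => hF hγ)
  omega

end EtaleLemmas

section ConvolutionSections

open FellBundle

variable {G : Type u} [ArrowGroupoid G] [TopologicalSpace G] [IsEtale G] [T2Space G]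
variable {B : G → Type v} [∀ γ, NormedAddCommGroup (B γ)] [∀ γ, NormedSpace ℂ (B γ)]
  [TopologicalSpace (TotalSpace Unit B)] [FellBundle B]

theorem continuousAt_convFun {f g : ∀ γ, B γ} (hf : Continuous (toTotal f))
    (hg : Continuous (toTotal g)) {K : Set G} (hK : IsCompact K) (hfK : ∀ γ ∉ K, f γ = 0)
    (γ₀ : G) : ContinuousAt (toTotal (convFun f g)) γ₀ := by
  classical
  have hfin := finite_fibre_r hK (r γ₀)
  obtain ⟨U, hU, hdisj⟩ := hfin.t2_separation
  have hloc : ∀ η : G, ∃ e : OpenPartialHomeomorph G (Units G), η ∈ e.source ∧ e.source ⊆ U η ∧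
      ∀ ξ ∈ e.source, e ξ = rangeUnit ξ := by
    intro η
    obtain ⟨e, he, hr⟩ := IsEtale.isLocalHomeomorph_range (G := G) η
    refine ⟨e.restrOpen (U η) (hU η).2, ?_, ?_, ?_⟩
    · simpa using ⟨he, (hU η).1⟩
    · rw [OpenPartialHomeomorph.restrOpen_source]; exact Set.inter_subset_right
    · intro ξ _; rw [hr]; rfl
  choose e he heU her using hloc
  -- the local sections of the range map
  have hσ : ∀ η γ, rangeUnit γ ∈ (e η).target →
      (e η).symm (rangeUnit γ) ∈ (e η).source ∧ r ((e η).symm (rangeUnit γ)) = r γ := by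
    intro η γ h
    have h1 := (e η).map_target h
    refine ⟨h1, ?_⟩
    have h2 := her η _ h1
    rw [(e η).right_inv h] at h2
    exact (congrArg Subtype.val h2).symm
  let t : G → ∀ γ, B γ := fun η γ =>
    if h : rangeUnit γ ∈ (e η).target then
      mul (isProd_left (hσ η γ h).2) (f ((e η).symm (rangeUnit γ)))
        (g (((e η).symm (rangeUnit γ))⁻¹ * γ))
    else 0
  have hrc : Continuous (rangeUnit : G → Units G) :=
    (IsEtale.isLocalHomeomorph_range (G := G)).continuous
  have htcont : ∀ η ∈ hfin.toFinset, ContinuousAt (toTotal (t η)) γ₀ := by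
    intro η hη
    have hη' : r η = r γ₀ := ((Set.Finite.mem_toFinset _).1 hη).2
    have hη0 : rangeUnit γ₀ ∈ (e η).target := by
      have := (e η).map_source (he η)
      rw [her η η (he η)] at this
      convert this using 1
      exact Subtype.ext hη'.symm
    let W : Set G := {γ | rangeUnit γ ∈ (e η).target}
    have hW : IsOpen W := (e η).open_target.preimage hrc
    suffices ContinuousOn (toTotal (t η)) W from this.continuousAt (hW.mem_nhds hη0)
    have hs1 : ContinuousOn (fun γ => (e η).symm (rangeUnit γ)) W :=
      (e η).continuousOn_symm.comp hrc.continuousOn (fun γ hγ => hγ)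
    have hs2 : ContinuousOn (fun γ => ((e η).symm (rangeUnit γ))⁻¹ * γ) W := by
      refine (IsEtale.continuousOn_mul (G := G)).comp
        ((IsEtale.continuous_inv.comp_continuousOn hs1).prodMk continuousOn_id) ?_
      intro γ hγ
      simp [s_inv, (hσ η γ hγ).2]
    have hpair : Continuous (fun γ : W =>
        (⟨(toTotal f ((e η).symm (rangeUnit γ.1)),
          toTotal g (((e η).symm (rangeUnit γ.1))⁻¹ * γ.1)), (isProd_left (hσ η γ.1 γ.2).2).1⟩ :
          {q : TotalSpace Unit B × TotalSpace Unit B // s q.1.proj = r q.2.proj})) := by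
      refine Continuous.subtype_mk (Continuous.prodMk ?_ ?_) _
      · exact hf.comp hs1.domRestrict
      · exact hg.comp hs2.domRestrict
    rw [continuousOn_iff_continuous_domRestrict]
    convert (FellBundle.continuous_mul (B := B)).comp hpair using 1
    funext γ
    have hpr := isProd_left (hσ η γ.1 γ.2).2
    have key : ∀ (ξ ζ δ : G) (h : IsProd ξ ζ δ) (a : B ξ) (b : B ζ),
        (⟨δ, mul h a b⟩ : TotalSpace Unit B) = ⟨ξ * ζ, mul ⟨h.1, rfl⟩ a b⟩ := by
      rintro ξ ζ δ ⟨h, rfl⟩ a b; rfl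
    have ht : t η γ.1 = mul hpr (f ((e η).symm (rangeUnit γ.1)))
        (g (((e η).symm (rangeUnit γ.1))⁻¹ * γ.1)) := dif_pos γ.2
    simp only [Set.domRestrict_apply, toTotal, Function.comp_apply]
    rw [ht]
    exact key _ _ _ hpr _ _
  have hsum := continuousAt_sum_section hfin.toFinset t htcont
  refine hsum.congr ?_
  -- near `γ₀` the convolution is the finite sum of the `t η`
  have hK' : IsCompact (K \ ⋃ η ∈ hfin.toFinset, (e η).source) :=
    hK.diff (isOpen_biUnion fun η _ => (e η).open_source)
  have hev1 : ∀ᶠ γ in 𝓝 γ₀, r γ ∉ r '' (K \ ⋃ η ∈ hfin.toFinset, (e η).source) := by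
    have hcl : IsClosed (r '' (K \ ⋃ η ∈ hfin.toFinset, (e η).source)) :=
      (hK'.image continuous_r).isClosed
    refine (continuous_r.tendsto γ₀).eventually (hcl.isOpen_compl.mem_nhds ?_)
    rintro ⟨η, ⟨hηK, hη⟩, hηr⟩
    exact hη (Set.mem_biUnion ((Set.Finite.mem_toFinset _).2 ⟨hηK, hηr⟩) (he η))
  have hev2 : ∀ᶠ γ in 𝓝 γ₀, ∀ η ∈ hfin.toFinset, rangeUnit γ ∈ (e η).target := by
    rw [Filter.eventually_all_finset]
    intro η hη
    have hη' : r η = r γ₀ := ((Set.Finite.mem_toFinset _).1 hη).2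
    refine hrc.continuousAt.eventually ((e η).open_target.mem_nhds ?_)
    have := (e η).map_source (he η)
    rw [her η η (he η)] at this
    convert this using 1
    exact Subtype.ext hη'.symm
  filter_upwards [hev1, hev2] with γ h1 h2
  refine congrArg (fun b => (⟨γ, b⟩ : TotalSpace Unit B)) ?_
  rw [Finset.sum_apply]
  let φ : {η // η ∈ hfin.toFinset} → {η : G // r η = r γ} := fun η =>
    ⟨(e η.1).symm (rangeUnit γ), (hσ η.1 γ (h2 _ η.2)).2⟩
  have hφ : Function.Injective φ := by
    intro a b hab
    have hab' : (e a.1).symm (rangeUnit γ) = (e b.1).symm (rangeUnit γ) := congrArg Subtype.val hab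
    by_contra hne
    have hd := hdisj ((Set.Finite.mem_toFinset _).1 a.2) ((Set.Finite.mem_toFinset _).1 b.2)
      (fun h => hne (Subtype.ext h))
    refine Set.disjoint_left.1 hd (heU _ (hσ a.1 γ (h2 _ a.2)).1) ?_
    rw [hab']
    exact heU _ (hσ b.1 γ (h2 _ b.2)).1
  unfold convFun
  rw [finsum_eq_sum_of_support_subset (s := hfin.toFinset.attach.image φ)]
  · rw [Finset.sum_image (fun a _ b _ h => hφ h), ← Finset.sum_attach hfin.toFinset]
    refine Finset.sum_congr rfl fun η _ => ?_
    exact dif_pos (h2 _ η.2)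
  · intro η hη
    have hηK : η.1 ∈ K := by
      by_contra hc
      exact hη (by simp [hfK _ hc])
    have : η.1 ∈ ⋃ η ∈ hfin.toFinset, (e η).source := by
      by_contra hc
      exact h1 ⟨η.1, ⟨hηK, hc⟩, η.2⟩
    obtain ⟨ξ, hξ, hηξ⟩ := Set.mem_iUnion₂.1 this
    rw [Finset.mem_coe, Finset.mem_image]
    refine ⟨⟨ξ, hξ⟩, Finset.mem_attach _ _, Subtype.ext ?_⟩
    change (e ξ).symm (rangeUnit γ) = η.1
    have : rangeUnit γ = e ξ η.1 := by
      rw [her ξ _ hηξ]; exact Subtype.ext η.2.symm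
    rw [this, (e ξ).left_inv hηξ]

/-- Convolution on `Γ_c(G; B)`. -/
instance : Mul (CcSection B) where
  mul f g := CcSection.mk (convFun f g) (by
    obtain ⟨K, hK, hfK⟩ := f.exists_compact
    exact continuous_iff_continuousAt.2 fun γ =>
      continuousAt_convFun f.continuous g.continuous hK hfK γ) (by
    obtain ⟨K, hK, hfK⟩ := f.exists_compact
    obtain ⟨L, hL, hgL⟩ := g.exists_compact
    have hc : IsCompact ((K ×ˢ L) ∩ {q : G × G | s q.1 = r q.2}) :=
      (hK.prod hL).inter_right (isClosed_eq (continuous_s.comp continuous_fst)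
        (continuous_r.comp continuous_snd))
    refine ⟨_, hc.image_of_continuousOn
      ((IsEtale.continuousOn_mul (G := G)).mono Set.inter_subset_right), fun γ hγ => ?_⟩
    refine finsum_eq_zero_of_forall_eq_zero fun η => ?_
    by_cases h1 : η.1 ∈ K
    · by_cases h2 : η.1⁻¹ * γ ∈ L
      · exact absurd ⟨(η.1, η.1⁻¹ * γ), ⟨⟨h1, h2⟩, (isProd_left η.2).1⟩, (isProd_left η.2).2⟩ hγ
      · rw [hgL _ h2, FellBundle.mul_zero]
    · rw [hfK _ h1, FellBundle.zero_mul])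

/-- The involution on `Γ_c(G; B)`. -/
instance : Star (CcSection B) where
  star f := CcSection.mk (starFun f) (by
    have h := (FellBundle.continuous_adj (B := B)).comp
      (f.continuous.comp (IsEtale.continuous_inv (G := G)))
    convert h using 1
    funext γ
    have key : ∀ (δ ε : G) (h : ε = δ⁻¹) (a : B δ),
        (⟨ε, adj h a⟩ : TotalSpace Unit B) = ⟨δ⁻¹, adj rfl a⟩ := by
      rintro δ ε rfl a; rfl
    exact key _ _ _ _) (by
    obtain ⟨K, hK, hfK⟩ := f.exists_compact
    refine ⟨_, hK.image (IsEtale.continuous_inv (G := G)), fun γ hγ => ?_⟩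
    have : γ⁻¹ ∉ K := fun h => hγ ⟨γ⁻¹, h, inv_inv' γ⟩
    simp [starFun, hfK _ this])

theorem CcSection.mul_apply (f g : CcSection B) (γ : G) : (f * g) γ = convFun f g γ := rfl

theorem CcSection.star_apply (f : CcSection B) (γ : G) :
    (star f) γ = adj (inv_inv' γ).symm (f γ⁻¹) := rfl

end ConvolutionSections

section FibreAlgebra

open FellBundle

variable {G : Type u} [ArrowGroupoid G] [TopologicalSpace G]
variable (B : G → Type v) [∀ γ, NormedAddCommGroup (B γ)] [∀ γ, NormedSpace ℂ (B γ)]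
  [TopologicalSpace (TotalSpace Unit B)] [FellBundle B]

/-- The C*-algebra `A_u = B_u` over a unit `u`. -/
def FibreAlg (u : Units G) : Type v := B u.1

variable {B} in
/-- The identity map from the fibre over `u` to `A_u`. -/
def FibreAlg.of {u : Units G} (a : B u.1) : FibreAlg B u := a

variable {B} in
/-- The identity map from `A_u` to the fibre over `u`. -/
def FibreAlg.val {u : Units G} (a : FibreAlg B u) : B u.1 := a

variable {B} in
/-- The product of `A_u`. -/
def FibreAlg.mul' {u : Units G} (a b : FibreAlg B u) : FibreAlg B u :=
  FellBundle.mul (B := B) (isProd_unit u) a b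

variable {B} in
/-- The involution of `A_u`. -/
def FibreAlg.star' {u : Units G} (a : FibreAlg B u) : FibreAlg B u :=
  FellBundle.adj (B := B) (inv_unit u).symm a

instance (u : Units G) : NormedAddCommGroup (FibreAlg B u) :=
  inferInstanceAs (NormedAddCommGroup (B u.1))
instance (u : Units G) : NormedSpace ℂ (FibreAlg B u) :=
  inferInstanceAs (NormedSpace ℂ (B u.1))

instance (u : Units G) : NonUnitalCStarAlgebra (FibreAlg B u) where
  __ := (inferInstance : NormedAddCommGroup (FibreAlg B u))
  __ := (inferInstance : NormedSpace ℂ (FibreAlg B u))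
  mul := FibreAlg.mul'
  left_distrib a b c := FellBundle.mul_add (B := B) (isProd_unit u) a b c
  right_distrib a b c := FellBundle.add_mul (B := B) (isProd_unit u) a b c
  zero_mul a := FellBundle.zero_mul (B := B) (isProd_unit u) a
  mul_zero a := FellBundle.mul_zero (B := B) (isProd_unit u) a
  mul_assoc a b c := FellBundle.mul_assoc (B := B) _ _ _ _ a b c
  norm_mul_le a b := FellBundle.norm_mul_le (B := B) _ a b
  star := FibreAlg.star'
  star_involutive a := FellBundle.adj_adj (B := B) _ _ a
  star_mul a b := FellBundle.adj_mul (B := B) _ _ _ _ _ a b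
  star_add a b := FellBundle.adj_add (B := B) _ a b
  star_smul z a := FellBundle.adj_smul (B := B) _ z a
  smul_assoc z a b := FellBundle.smul_mul (B := B) _ z a b
  smul_comm z a b := (FellBundle.mul_smul (B := B) _ z a b).symm
  toCompleteSpace := IsBanachBundle.completeSpace (B := B) u.1
  norm_mul_self_le a := by
    have h := FellBundle.norm_adj_mul_self' (B := B) (inv_unit u).symm (isProd_unit u) a
    rw [sq] at h
    exact h.symm.le

theorem FibreAlg.of_mul {u : Units G} (a b : B u.1) :
    FibreAlg.of (FellBundle.mul (isProd_unit u) a b) = FibreAlg.of a * FibreAlg.of b := rfl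

theorem FibreAlg.of_adj {u : Units G} (a : B u.1) :
    FibreAlg.of (FellBundle.adj (inv_unit u).symm a) = star (FibreAlg.of a) := rfl

theorem FibreAlg.of_sum {ι : Type*} {u : Units G} (S : Finset ι) (a : ι → B u.1) :
    FibreAlg.of (∑ i ∈ S, a i) = ∑ i ∈ S, FibreAlg.of (a i) := rfl

end FibreAlgebra

section Module

open FellBundle

variable {G : Type u} [ArrowGroupoid G] [TopologicalSpace G]
variable (B : G → Type v) [∀ γ, NormedAddCommGroup (B γ)] [∀ γ, NormedSpace ℂ (B γ)]
  [TopologicalSpace (TotalSpace Unit B)] [FellBundle B]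

/-- Finitely supported sections over `G_u`. -/
def xuSubmodule (u : Units G) : Submodule ℂ (∀ η : {η : G // s η = u.1}, B η.1) where
  carrier := {h | {η | h η ≠ 0}.Finite}
  add_mem' {h k} hh hk := (hh.union hk).subset fun η hη => by
    by_contra hc
    rw [Set.mem_union, not_or] at hc
    simp only [Set.mem_ofPred_eq, not_not] at hc
    exact hη (by simp [hc.1, hc.2])
  zero_mem' := by simp
  smul_mem' c h hh := hh.subset fun η hη hc => hη (by simp [hc])

/-- `Γ_c(G_u; B)`: since `G_u` is closed and discrete, this is the space of the finitely supported
functions `h` on `G_u` with `h η ∈ B η`. With the norm below, it is a dense subspace of the right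
Hilbert `A_u`-module `X_u`. -/
def Xu (u : Units G) : Type max u v := xuSubmodule B u

variable (u : Units G)

instance : AddCommGroup (Xu B u) := inferInstanceAs (AddCommGroup (xuSubmodule B u))
instance : Module ℂ (Xu B u) := inferInstanceAs (Module ℂ (xuSubmodule B u))

variable {B u}

/-- The underlying function. -/
def Xu.toFun (h : Xu B u) : ∀ η : {η : G // s η = u.1}, B η.1 :=
  Subtype.val (p := (· ∈ xuSubmodule B u)) h

instance : CoeFun (Xu B u) (fun _ => ∀ η : {η : G // s η = u.1}, B η.1) := ⟨Xu.toFun⟩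

theorem Xu.finite (h : Xu B u) : {η | h η ≠ 0}.Finite :=
  Subtype.prop (p := (· ∈ xuSubmodule B u)) h

/-- A finitely supported function as an element of `Γ_c(G_u; B)`. -/
def Xu.mk (h : ∀ η : {η : G // s η = u.1}, B η.1) (hh : {η | h η ≠ 0}.Finite) : Xu B u :=
  Subtype.mk (p := (· ∈ xuSubmodule B u)) h hh

@[simp] theorem Xu.mk_apply (h : ∀ η : {η : G // s η = u.1}, B η.1) (hh) (η) :
    Xu.mk h hh η = h η := rfl

@[simp] theorem Xu.add_apply (h k : Xu B u) (η) : (h + k) η = h η + k η := rfl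
@[simp] theorem Xu.smul_apply (c : ℂ) (h : Xu B u) (η) : (c • h) η = c • h η := rfl
@[simp] theorem Xu.zero_apply (η) : (0 : Xu B u) η = 0 := rfl
theorem Xu.ext {h k : Xu B u} (H : ∀ η, h η = k η) : h = k := Subtype.ext (funext H)

/-- The support of a finitely supported function. -/
def Xu.supp (h : Xu B u) : Finset {η : G // s η = u.1} := h.finite.toFinset

theorem Xu.mem_supp (h : Xu B u) (η) : η ∈ h.supp ↔ h η ≠ 0 := Set.Finite.mem_toFinset _

theorem Xu.eq_zero_of_notMem (h : Xu B u) {S : Finset {η : G // s η = u.1}} (hS : h.supp ⊆ S)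
    {η} (hη : η ∉ S) : h η = 0 := by
  by_contra hc
  exact hη (hS ((h.mem_supp η).2 hc))

/-- The `A_u`-valued inner product `⟨h, k⟩ = ∑_{η ∈ G_u} h(η)* k(η)` (linear in the second
variable). -/
def Xu.ip (h k : Xu B u) : B u.1 :=
  ∑ᶠ η : {η : G // s η = u.1}, mul (isProd_inv η.2) (adj rfl (h η)) (k η)

theorem Xu.ip_eq (h k : Xu B u) (S : Finset {η : G // s η = u.1}) (hS : h.supp ⊆ S ∨ k.supp ⊆ S) :
    Xu.ip h k = ∑ η ∈ S, mul (isProd_inv η.2) (adj rfl (h η)) (k η) := by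
  refine finsum_eq_sum_of_support_subset _ fun η hη => ?_
  by_contra hc
  refine hη ?_
  rcases hS with hS | hS
  · simp [h.eq_zero_of_notMem hS hc]
  · simp [k.eq_zero_of_notMem hS hc]

/-- The norm of `X_u`, `‖h‖² = ‖⟨h, h⟩‖`. -/
instance : Norm (Xu B u) := ⟨fun h => √‖Xu.ip h h‖⟩

/-- The right action of `A_u` on `Γ_c(G_u; B)`, `(h · a)(η) = h(η) a`. -/
def Xu.act (h : Xu B u) (a : B u.1) : Xu B u :=
  Xu.mk (fun η => mul (isProd_source η.2) (h η) a)
    (h.finite.subset fun η hη hc => hη (by simp [hc]))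

theorem Xu.ip_add_right (h k l : Xu B u) : Xu.ip h (k + l) = Xu.ip h k + Xu.ip h l := by
  rw [Xu.ip_eq h _ h.supp (Or.inl subset_rfl), Xu.ip_eq h _ h.supp (Or.inl subset_rfl),
    Xu.ip_eq h _ h.supp (Or.inl subset_rfl), ← Finset.sum_add_distrib]
  exact Finset.sum_congr rfl fun η _ => FellBundle.mul_add _ _ _ _

theorem Xu.ip_smul_right (z : ℂ) (h k : Xu B u) : Xu.ip h (z • k) = z • Xu.ip h k := by
  rw [Xu.ip_eq h _ h.supp (Or.inl subset_rfl), Xu.ip_eq h _ h.supp (Or.inl subset_rfl),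
    Finset.smul_sum]
  exact Finset.sum_congr rfl fun η _ => FellBundle.mul_smul _ _ _ _

theorem Xu.ip_act_right (h k : Xu B u) (a : B u.1) :
    Xu.ip h (k.act a) = mul (isProd_unit u) (Xu.ip h k) a := by
  rw [Xu.ip_eq h _ h.supp (Or.inl subset_rfl), Xu.ip_eq h _ h.supp (Or.inl subset_rfl),
    FellBundle.sum_mul]
  exact Finset.sum_congr rfl fun η _ => (FellBundle.mul_assoc _ _ _ _ _ _ _).symm

theorem Xu.adj_ip (h k : Xu B u) : adj (inv_unit u).symm (Xu.ip h k) = Xu.ip k h := by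
  rw [Xu.ip_eq h k h.supp (Or.inl subset_rfl), Xu.ip_eq k h h.supp (Or.inr subset_rfl),
    FellBundle.adj_sum]
  refine Finset.sum_congr rfl fun η _ => ?_
  rw [adj_mul (h' := isProd_inv η.2) (hγ := (inv_inv' η.1).symm) (hη := rfl), adj_adj]

section Order

attribute [local instance] CStarAlgebra.spectralOrder CStarAlgebra.spectralOrderedRing

theorem fibre_nonneg {η : G} (h : IsProd η⁻¹ η u.1) (a : B η) :
    0 ≤ FibreAlg.of (mul h (adj rfl a) a) := by
  have hu : IsProd u.1⁻¹ u.1 u.1 := isProd_inv (s_unit u)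
  obtain ⟨c, hc⟩ := adj_mul_self_nonneg h hu a
  have : FibreAlg.of (mul h (adj rfl a) a) = star (FibreAlg.of c) * FibreAlg.of c := by
    rw [hc, ← FibreAlg.of_adj, ← FibreAlg.of_mul]
    have key : ∀ (w : G) (hw : w = u.1⁻¹) (h1 : IsProd w u.1 u.1),
        mul hu (adj rfl c) c = mul h1 (adj hw c) c := by
      rintro w rfl h1; rfl
    rw [key u.1 (inv_unit u).symm (isProd_unit u)]
  rw [this]
  exact star_mul_self_nonneg _

theorem Xu.ip_self_nonneg (h : Xu B u) : 0 ≤ FibreAlg.of (Xu.ip h h) := by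
  rw [Xu.ip_eq h h h.supp (Or.inl subset_rfl), FibreAlg.of_sum]
  exact Finset.sum_nonneg fun η _ => fibre_nonneg (isProd_inv η.2) (h η)

theorem Xu.ip_self_eq_zero (h : Xu B u) (h0 : FibreAlg.of (Xu.ip h h) = 0) : h = 0 := by
  refine Xu.ext fun η => ?_
  by_contra hη
  have hmem : η ∈ h.supp := (h.mem_supp η).2 hη
  rw [Xu.ip_eq h h h.supp (Or.inl subset_rfl), FibreAlg.of_sum] at h0
  have h1 := (Finset.sum_eq_zero_iff_of_nonneg
    (fun η _ => fibre_nonneg (isProd_inv η.2) (h η))).1 h0 η hmem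
  have h2 := norm_adj_mul_self (isProd_inv η.2) (h η)
  have h3 : mul (isProd_inv η.2) (adj rfl (h η)) (h η) = (0 : B u.1) := h1
  rw [h3, norm_zero] at h2
  exact hη (norm_eq_zero.1 (pow_eq_zero_iff two_ne_zero |>.1 h2.symm))

theorem mulOpposite_op_nonneg {a : FibreAlg B u} (ha : 0 ≤ a) : 0 ≤ MulOpposite.op a := by
  obtain ⟨b, rfl⟩ := CStarAlgebra.nonneg_iff_eq_star_mul_self.1 ha
  rw [MulOpposite.op_mul, MulOpposite.op_star]
  exact mul_star_self_nonneg _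

instance : SMul (FibreAlg B u)ᵐᵒᵖ (Xu B u) := ⟨fun a h => h.act a.unop.val⟩

/-- `Γ_c(G_u; B)` as a (pre-)Hilbert module; Mathlib's Hilbert modules have the algebra acting on
the left, whence the opposite algebra. -/
@[reducible] def xuCStarModule : CStarModule (FibreAlg B u)ᵐᵒᵖ (Xu B u) where
  inner h k := MulOpposite.op (FibreAlg.of (Xu.ip h k))
  inner_add_right := by intro h k l; rw [Xu.ip_add_right]; rfl
  inner_self_nonneg {h} := mulOpposite_op_nonneg h.ip_self_nonneg
  inner_self {h} := by
    constructor
    · intro h0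
      exact h.ip_self_eq_zero (MulOpposite.op_injective h0)
    · rintro rfl
      rw [Xu.ip_eq 0 0 ∅ (Or.inl ?_)]
      · rfl
      · intro η hη
        exact absurd rfl ((Xu.mem_supp 0 η).1 hη)
  inner_op_smul_right {a h k} := by
    change MulOpposite.op (FibreAlg.of (Xu.ip h (k.act a.unop.val))) = _
    rw [Xu.ip_act_right]; rfl
  inner_smul_right_complex {z h k} := by rw [Xu.ip_smul_right]; rfl
  star_inner h k := by rw [← MulOpposite.op_star, ← FibreAlg.of_adj, Xu.adj_ip]
  norm_eq_sqrt_norm_inner_self h := rfl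

instance : NormedAddCommGroup (Xu B u) :=
  letI := xuCStarModule (B := B) (u := u)
  NormedAddCommGroup.ofCore (CStarModule.normedSpaceCore (FibreAlg B u)ᵐᵒᵖ)

instance : NormedSpace ℂ (Xu B u) :=
  letI := xuCStarModule (B := B) (u := u)
  NormedSpace.ofCore (CStarModule.normedSpaceCore (FibreAlg B u)ᵐᵒᵖ)

theorem Xu.norm_ip_le (h k : Xu B u) : ‖Xu.ip h k‖ ≤ ‖h‖ * ‖k‖ := by
  let _ := xuCStarModule (B := B) (u := u)
  exact CStarModule.norm_inner_le (A := (FibreAlg B u)ᵐᵒᵖ) (Xu B u) (x := h) (y := k)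

end Order

theorem Xu.norm_sq (h : Xu B u) : ‖h‖ ^ 2 = ‖Xu.ip h h‖ := Real.sq_sqrt (norm_nonneg _)

end Module

section RegularRepresentation

open FellBundle

variable {G : Type u} [ArrowGroupoid G] [TopologicalSpace G] [IsEtale G] [T2Space G]
variable {B : G → Type v} [∀ γ, NormedAddCommGroup (B γ)] [∀ γ, NormedSpace ℂ (B γ)]
  [TopologicalSpace (TotalSpace Unit B)] [FellBundle B] {u : Units G}

theorem s_inv_mul_mem (ζ : {ζ : G // s ζ = u.1}) {η : G} (h : r η = r ζ.1) :
    s (η⁻¹ * ζ.1) = u.1 := by rw [← (isProd_left h).s_eq, ζ.2]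

/-- `(V_u(f) h)(ζ) = ∑_{η ∈ G^{r(ζ)}} f(η) h(η⁻¹ζ)` for `ζ ∈ G_u`. -/
def regFun (f : ∀ γ, B γ) (h : ∀ η : {η : G // s η = u.1}, B η.1) (ζ : {ζ : G // s ζ = u.1}) :
    B ζ.1 :=
  ∑ᶠ η : {η : G // r η = r ζ.1}, mul (isProd_left η.2) (f η.1)
    (h ⟨η.1⁻¹ * ζ.1, s_inv_mul_mem ζ η.2⟩)

/-- The bijection `η ↦ η⁻¹ζ` from `G^{r(ζ)}` to `G_u`. -/
def fibreEquiv (ζ : {ζ : G // s ζ = u.1}) : {η : G // r η = r ζ.1} ≃ {τ : G // s τ = u.1} where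
  toFun η := ⟨η.1⁻¹ * ζ.1, s_inv_mul_mem ζ η.2⟩
  invFun τ := ⟨ζ.1 * τ.1⁻¹, ((isProd_right (ζ.2.trans τ.2.symm)).r_eq).symm⟩
  left_inv η := Subtype.ext (eq_mul_inv (isProd_left η.2))
  right_inv τ := Subtype.ext (eq_inv_mul (isProd_right (ζ.2.trans τ.2.symm)))

theorem regFun_eq (f : ∀ γ, B γ) (h : Xu B u) (ζ : {ζ : G // s ζ = u.1})
    (S : Finset {η : G // s η = u.1}) (hS : h.supp ⊆ S) :
    regFun f h ζ = ∑ τ ∈ S, mul (isProd_right (ζ.2.trans τ.2.symm)) (f (ζ.1 * τ.1⁻¹)) (h τ) := by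
  rw [← finsum_eq_sum_of_support_subset
    (fun τ : {η : G // s η = u.1} =>
      mul (isProd_right (ζ.2.trans τ.2.symm)) (f (ζ.1 * τ.1⁻¹)) (h τ)) (s := S)]
  · rw [← finsum_comp_equiv (fibreEquiv ζ)]
    refine finsum_congr fun η => ?_
    exact mul_congr_left f (eq_mul_inv (isProd_left η.2)).symm _ _ _
  · intro τ hτ
    by_contra hc
    exact hτ (by simp [h.eq_zero_of_notMem hS hc])

theorem regFun_finite (f : CcSection B) (h : Xu B u) : {ζ | regFun (u := u) f h ζ ≠ 0}.Finite := by
  classical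
  obtain ⟨K, hK, hfK⟩ := f.exists_compact
  have hfin : (⋃ τ ∈ h.supp, {ζ : {ζ : G // s ζ = u.1} | ζ.1 * τ.1⁻¹ ∈ K}).Finite := by
    refine Set.Finite.biUnion (Finset.finite_toSet _) fun τ _ => ?_
    refine Set.Finite.of_finite_image (f := fun ζ : {ζ : G // s ζ = u.1} => ζ.1 * τ.1⁻¹)
      ((finite_fibre_s hK (r τ.1)).subset ?_) ?_
    · rintro _ ⟨ζ, hζ, rfl⟩
      exact ⟨hζ, (isProd_right (ζ.2.trans τ.2.symm)).1⟩
    · intro a _ b _ hab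
      refine Subtype.ext ?_
      have h1 := (isProd_right (a.2.trans τ.2.symm)).2
      have h2 := (isProd_right (b.2.trans τ.2.symm)).2
      rw [← h1, ← h2]
      exact congrArg (· * τ.1) hab
  refine hfin.subset fun ζ hζ => ?_
  by_contra hc
  refine hζ ?_
  rw [regFun_eq _ h ζ h.supp subset_rfl]
  refine Finset.sum_eq_zero fun τ hτ => ?_
  have : ζ.1 * τ.1⁻¹ ∉ K := fun hk => hc (Set.mem_biUnion hτ hk)
  rw [hfK _ this, FellBundle.zero_mul]

/-- The action `V_u(f)` of `f ∈ Γ_c(G; B)` on `Γ_c(G_u; B)`, as a linear map. -/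
def regₗ (u : Units G) (f : CcSection B) : Xu B u →ₗ[ℂ] Xu B u where
  toFun h := Xu.mk (regFun f h) (regFun_finite f h)
  map_add' h k := by
    classical
    refine Xu.ext fun ζ => ?_
    rw [Xu.add_apply, Xu.mk_apply, Xu.mk_apply, Xu.mk_apply,
      regFun_eq _ (h + k) ζ ((h + k).supp ∪ (h.supp ∪ k.supp)) Finset.subset_union_left,
      regFun_eq _ h ζ ((h + k).supp ∪ (h.supp ∪ k.supp))
        (Finset.subset_union_left.trans Finset.subset_union_right),
      regFun_eq _ k ζ ((h + k).supp ∪ (h.supp ∪ k.supp))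
        (Finset.subset_union_right.trans Finset.subset_union_right), ← Finset.sum_add_distrib]
    exact Finset.sum_congr rfl fun τ _ => FellBundle.mul_add _ _ _ _
  map_smul' z h := by
    classical
    refine Xu.ext fun ζ => ?_
    rw [RingHom.id_apply, Xu.smul_apply, Xu.mk_apply, Xu.mk_apply,
      regFun_eq _ (z • h) ζ ((z • h).supp ∪ h.supp) Finset.subset_union_left,
      regFun_eq _ h ζ ((z • h).supp ∪ h.supp) Finset.subset_union_right, Finset.smul_sum]
    exact Finset.sum_congr rfl fun τ _ => FellBundle.mul_smul _ _ _ _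

theorem regₗ_apply (f : CcSection B) (h : Xu B u) (ζ) : regₗ u f h ζ = regFun f h ζ := rfl

theorem regₗ_eq (f : CcSection B) (h : Xu B u) (ζ : {ζ : G // s ζ = u.1})
    (S : Finset {η : G // s η = u.1}) (hS : h.supp ⊆ S) :
    regₗ u f h ζ = ∑ τ ∈ S, mul (isProd_right (ζ.2.trans τ.2.symm)) (f (ζ.1 * τ.1⁻¹)) (h τ) :=
  regFun_eq _ h ζ S hS

theorem regₗ_add (f g : CcSection B) (h : Xu B u) :
    regₗ u (f + g) h = regₗ u f h + regₗ u g h := by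
  refine Xu.ext fun ζ => ?_
  rw [Xu.add_apply, regₗ_eq _ _ _ h.supp subset_rfl, regₗ_eq _ _ _ h.supp subset_rfl,
    regₗ_eq _ _ _ h.supp subset_rfl, ← Finset.sum_add_distrib]
  exact Finset.sum_congr rfl fun τ _ => FellBundle.add_mul _ _ _ _

theorem regₗ_smul (z : ℂ) (f : CcSection B) (h : Xu B u) : regₗ u (z • f) h = z • regₗ u f h := by
  refine Xu.ext fun ζ => ?_
  rw [Xu.smul_apply, regₗ_eq _ _ _ h.supp subset_rfl, regₗ_eq _ _ _ h.supp subset_rfl,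
    Finset.smul_sum]
  exact Finset.sum_congr rfl fun τ _ => FellBundle.smul_mul _ _ _ _

/-- `V_u(f * g) = V_u(f) V_u(g)`. -/
theorem regₗ_mul (f g : CcSection B) (h : Xu B u) : regₗ u (f * g) h = regₗ u f (regₗ u g h) := by
  refine Xu.ext fun ζ => ?_
  obtain ⟨K, hK, hfK⟩ := f.exists_compact
  have hinj : Set.InjOn (fun η : {η : G // r η = r ζ.1} => η.1) Set.univ :=
    fun a _ b _ h => Subtype.ext h
  have hfin : {η : {η : G // r η = r ζ.1} | η.1 ∈ K}.Finite :=
    Set.Finite.of_finite_image ((finite_fibre_r hK (r ζ.1)).subset (by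
      rintro _ ⟨η, hη, rfl⟩; exact ⟨hη, η.2⟩)) (hinj.mono (Set.subset_univ _))
  rw [regₗ_eq _ _ _ h.supp subset_rfl, regₗ_apply]
  unfold regFun
  rw [finsum_eq_sum_of_support_subset (s := hfin.toFinset)]
  swap
  · intro η hη
    rw [Set.Finite.coe_toFinset]
    by_contra hc
    exact hη (mul_of_left_eq_zero _ (hfK _ hc) _)
  simp_rw [regₗ_eq g h _ h.supp subset_rfl, FellBundle.mul_sum]
  rw [Finset.sum_comm]
  refine Finset.sum_congr rfl fun τ _ => ?_
  have hτ := isProd_right (ζ.2.trans τ.2.symm)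
  have hr : r (ζ.1 * τ.1⁻¹) = r ζ.1 := hτ.r_eq.symm
  have hconv : (f * g) (ζ.1 * τ.1⁻¹) = ∑ η ∈ hfin.toFinset,
      mul (isProd_left (η.2.trans hr.symm)) (f η.1) (g (η.1⁻¹ * (ζ.1 * τ.1⁻¹))) := by
    rw [CcSection.mul_apply]
    unfold convFun
    let e : {η : G // r η = r ζ.1} ≃ {η : G // r η = r (ζ.1 * τ.1⁻¹)} :=
      Equiv.subtypeEquivRight fun η => by rw [hr]
    rw [← finsum_comp_equiv e]
    refine finsum_eq_sum_of_support_subset _ fun η hη => ?_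
    rw [Set.Finite.coe_toFinset]
    by_contra hc
    refine hη ?_
    exact mul_of_left_eq_zero _ (hfK _ hc) _
  rw [hconv, FellBundle.sum_mul]
  refine Finset.sum_congr rfl fun η _ => ?_
  have h1 : s (η.1⁻¹ * ζ.1) = s τ.1 := (s_inv_mul_mem ζ η.2).trans τ.2.symm
  have e : η.1⁻¹ * (ζ.1 * τ.1⁻¹) = η.1⁻¹ * ζ.1 * τ.1⁻¹ :=
    (assoc (by rw [s_inv, η.2]) (by rw [r_inv, ζ.2, τ.2])).symm
  have h3 : IsProd (η.1⁻¹ * (ζ.1 * τ.1⁻¹)) τ.1 (η.1⁻¹ * ζ.1) := by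
    rw [e]; exact isProd_right h1
  rw [FellBundle.mul_assoc _ _ h3 (isProd_left η.2)]
  refine congrArg _ ?_
  exact mul_congr_left (fun γ => g γ) e _ _ _

/-- `⟨V_u(f) h, k⟩ = ⟨h, V_u(f*) k⟩`. -/
theorem ip_regₗ (f : CcSection B) (h k : Xu B u) :
    Xu.ip (regₗ u f h) k = Xu.ip h (regₗ u (star f) k) := by
  rw [Xu.ip_eq _ k k.supp (Or.inr subset_rfl), Xu.ip_eq h _ h.supp (Or.inl subset_rfl)]
  simp_rw [regₗ_eq f h _ h.supp subset_rfl, regₗ_eq (star f) k _ k.supp subset_rfl,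
    FellBundle.mul_sum, FellBundle.adj_sum, FellBundle.sum_mul]
  rw [Finset.sum_comm]
  refine Finset.sum_congr rfl fun τ _ => Finset.sum_congr rfl fun ζ _ => ?_
  have h0 := isProd_right (ζ.2.trans τ.2.symm)
  have h1 := h0.inv
  have h2 := isProd_right (τ.2.trans ζ.2.symm)
  have e : (τ.1 * ζ.1⁻¹)⁻¹ = ζ.1 * τ.1⁻¹ := by
    have := (h2.inv)
    have h3 := eq_inv_mul this
    rw [inv_inv'] at h3
    exact h3.symm
  have e' : (ζ.1 * τ.1⁻¹)⁻¹ = τ.1 * ζ.1⁻¹ := by rw [← e, inv_inv']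
  rw [adj_mul h0 h1 rfl rfl rfl]
  have h4 : IsProd (ζ.1 * τ.1⁻¹)⁻¹ ζ.1 τ.1 := by rw [e']; exact h2
  rw [FellBundle.mul_assoc h1 _ h4 (isProd_inv τ.2)]
  refine congrArg _ ?_
  rw [CcSection.star_apply]
  have key : ∀ (a b : G) (hab : a = b⁻¹) (hba : b = a⁻¹) (ha : IsProd a⁻¹ ζ.1 τ.1)
      (hb : IsProd b ζ.1 τ.1),
      mul ha (adj rfl (f a)) (k ζ) = mul hb (adj (inv_inv' b).symm (f b⁻¹)) (k ζ) := by
    rintro a b rfl hba ha hb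
    have : ∀ (c : G) (hc : c = b⁻¹⁻¹) (hc' : IsProd c ζ.1 τ.1),
        mul ha (adj rfl (f b⁻¹)) (k ζ) = mul hc' (adj hc (f b⁻¹)) (k ζ) := by
      rintro c rfl hc'; rfl
    exact this b _ hb
  exact key _ _ e.symm e'.symm h4 h2

/-- The `ℓ¹`-norm on `Γ_c(G_u; B)`. -/
def Xu.norm1 (h : Xu B u) : ℝ := ∑ η ∈ h.supp, ‖h η‖

theorem Xu.norm1_eq (h : Xu B u) (S) (hS : h.supp ⊆ S) : h.norm1 = ∑ η ∈ S, ‖h η‖ := by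
  refine Finset.sum_subset hS fun η _ hη => ?_
  rw [h.eq_zero_of_notMem subset_rfl hη, norm_zero]

theorem Xu.norm1_nonneg (h : Xu B u) : 0 ≤ h.norm1 := Finset.sum_nonneg fun _ _ => norm_nonneg _

theorem Xu.norm_le_norm1 (h : Xu B u) : ‖h‖ ≤ h.norm1 := by
  refine (sq_le_sq₀ (norm_nonneg h) h.norm1_nonneg).1 ?_
  rw [Xu.norm_sq, Xu.ip_eq h h h.supp (Or.inl subset_rfl)]
  calc _ ≤ ∑ η ∈ h.supp, ‖h η‖ ^ 2 := by
        refine (norm_sum_le _ _).trans (Finset.sum_le_sum fun η _ => ?_)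
        rw [norm_adj_mul_self]
    _ ≤ (∑ η ∈ h.supp, ‖h η‖) ^ 2 := by
        rw [sq (∑ η ∈ h.supp, ‖h η‖), Finset.sum_mul]
        refine Finset.sum_le_sum fun η hη => ?_
        rw [sq]
        exact mul_le_mul_of_nonneg_left
          (Finset.single_le_sum (f := fun η => ‖h η‖) (fun _ _ => norm_nonneg _) hη) (norm_nonneg _)

theorem exists_norm1_le (f : CcSection B) :
    ∃ C, 0 ≤ C ∧ ∀ (u : Units G) (h : Xu B u), (regₗ u f h).norm1 ≤ C * h.norm1 := by
  classical
  obtain ⟨K, hK, hfK⟩ := f.exists_compact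
  obtain ⟨N, hN⟩ := exists_bound_fibre_s hK
  obtain ⟨M, hM0, hM⟩ := f.bounded
  refine ⟨N * M, by positivity, fun u h => ?_⟩
  set T := (regₗ u f h).supp with hT
  calc (regₗ u f h).norm1 = ∑ ζ ∈ T, ‖regₗ u f h ζ‖ := rfl
    _ ≤ ∑ ζ ∈ T, ∑ τ ∈ h.supp, ‖f (ζ.1 * τ.1⁻¹)‖ * ‖h τ‖ := by
        refine Finset.sum_le_sum fun ζ _ => ?_
        rw [regₗ_eq _ _ _ h.supp subset_rfl]
        exact (norm_sum_le _ _).trans (Finset.sum_le_sum fun τ _ => FellBundle.norm_mul_le _ _ _)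
    _ = ∑ τ ∈ h.supp, (∑ ζ ∈ T, ‖f (ζ.1 * τ.1⁻¹)‖) * ‖h τ‖ := by
        rw [Finset.sum_comm]
        exact Finset.sum_congr rfl fun τ _ => (Finset.sum_mul _ _ _).symm
    _ ≤ ∑ τ ∈ h.supp, (N * M) * ‖h τ‖ := by
        refine Finset.sum_le_sum fun τ _ => mul_le_mul_of_nonneg_right ?_ (norm_nonneg _)
        have hinj : Function.Injective (fun ζ : {ζ : G // s ζ = u.1} => ζ.1 * τ.1⁻¹) := by
          intro a b hab
          refine Subtype.ext ?_
          have h1 := (isProd_right (a.2.trans τ.2.symm)).2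
          have h2 := (isProd_right (b.2.trans τ.2.symm)).2
          rw [← h1, ← h2]
          exact congrArg (· * τ.1) hab
        have h1 : ∑ ζ ∈ T, ‖f (ζ.1 * τ.1⁻¹)‖
            = ∑ ζ ∈ T.filter (fun ζ => ζ.1 * τ.1⁻¹ ∈ K), ‖f (ζ.1 * τ.1⁻¹)‖ := by
          rw [Finset.sum_filter]
          refine Finset.sum_congr rfl fun ζ _ => ?_
          split_ifs with hc
          · rfl
          · rw [hfK _ hc, norm_zero]
        rw [h1]
        refine (Finset.sum_le_card_nsmul _ _ M fun ζ _ => hM _).trans ?_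
        rw [nsmul_eq_mul]
        refine mul_le_mul_of_nonneg_right ?_ hM0
        rw [← Finset.card_image_of_injective _ hinj]
        refine Nat.cast_le.2 (hN (r τ.1) _ ?_)
        intro γ hγ
        obtain ⟨ζ, hζ, rfl⟩ := Finset.mem_image.1 hγ
        exact ⟨(Finset.mem_filter.1 hζ).2, (isProd_right (ζ.2.trans τ.2.symm)).1⟩
    _ = N * M * h.norm1 := by rw [← Finset.mul_sum]; rfl

theorem le_of_logConvex {a : ℕ → ℝ} {C K : ℝ} (h0 : ∀ n, 0 ≤ a n)
    (h1 : ∀ n, a (n + 1) ^ 2 ≤ a n * a (n + 2)) (hK : 0 ≤ K)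
    (hC : ∀ n, a n ≤ C * K ^ n) : a 1 ≤ K * a 0 := by
  by_contra hc
  push Not at hc
  have ha0 : 0 < a 0 := by
    rcases (h0 0).lt_or_eq with h | h
    · exact h
    · have := h1 0
      rw [← h] at this hc
      simp only [MulZeroClass.zero_mul, MulZeroClass.mul_zero] at this hc
      nlinarith
  set q := a 1 / a 0 with hq
  have hqK : K < q := by rw [hq, lt_div_iff₀ ha0]; exact hc
  have hq0 : 0 < q := hK.trans_lt hqK
  have hstep : ∀ n, 0 < a n ∧ q * a n ≤ a (n + 1) := by
    intro n
    induction n with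
    | zero => exact ⟨ha0, by rw [hq, div_mul_cancel₀ _ ha0.ne']⟩
    | succ n ih =>
      have hpos : 0 < a (n + 1) := (mul_pos hq0 ih.1).trans_le ih.2
      refine ⟨hpos, ?_⟩
      have := h1 n
      have h2 : a (n + 1) * (q * a n) ≤ a n * a (n + 2) :=
        (mul_le_mul_of_nonneg_left ih.2 hpos.le).trans (by rw [← sq]; exact this)
      have h3 : a n * (q * a (n + 1)) ≤ a n * a (n + 1 + 1) := by
        calc a n * (q * a (n + 1)) = a (n + 1) * (q * a n) := by ring
          _ ≤ _ := h2
      exact le_of_mul_le_mul_left h3 ih.1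
  have hpow : ∀ n, q ^ n * a 0 ≤ a n := by
    intro n
    induction n with
    | zero => simp
    | succ n ih =>
      calc q ^ (n + 1) * a 0 = q * (q ^ n * a 0) := by ring
        _ ≤ q * a n := mul_le_mul_of_nonneg_left ih hq0.le
        _ ≤ a (n + 1) := (hstep n).2
  have hlim : Tendsto (fun n => C * (K / q) ^ n) atTop (𝓝 (C * 0)) :=
    (tendsto_pow_atTop_nhds_zero_of_lt_one (by positivity) ((div_lt_one hq0).2 hqK)).const_mul C
  rw [MulZeroClass.mul_zero] at hlim
  obtain ⟨n, hn⟩ := (hlim.eventually_lt_const ha0).exists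
  have h5 := (hpow n).trans (hC n)
  rw [div_pow, mul_div_assoc', div_lt_iff₀ (pow_pos hq0 n)] at hn
  linarith [mul_comm (a 0) (q ^ n)]

theorem exists_norm_le (f : CcSection B) :
    ∃ C, 0 ≤ C ∧ ∀ (u : Units G) (h : Xu B u), ‖regₗ u f h‖ ≤ C * ‖h‖ := by
  obtain ⟨C₁, hC₁, H₁⟩ := exists_norm1_le f
  obtain ⟨C₂, hC₂, H₂⟩ := exists_norm1_le (star f)
  have hss : ∀ (u : Units G) (h k : Xu B u),
      Xu.ip (regₗ u (star f) h) k = Xu.ip h (regₗ u f k) := fun u h k => by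
    rw [← Xu.adj_ip, ← ip_regₗ, Xu.adj_ip]
  refine ⟨√(C₂ * C₁), Real.sqrt_nonneg _, fun u h => ?_⟩
  let S : Xu B u → Xu B u := fun k => regₗ u (star f) (regₗ u f k)
  have hS : ∀ k l, Xu.ip (S k) l = Xu.ip k (S l) := fun k l => by
    simp only [S]; rw [hss, ip_regₗ]
  have key : ‖S h‖ ≤ C₂ * C₁ * ‖h‖ := by
    have := le_of_logConvex (a := fun n => ‖S^[n] h‖) (C := h.norm1) (K := C₂ * C₁)
      (fun n => norm_nonneg _) (fun n => ?_) (by positivity) (fun n => ?_)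
    · simpa using this
    · rw [Xu.norm_sq]
      have e1 : S^[n + 1] h = S (S^[n] h) := Function.iterate_succ_apply' S n h
      have e2 : S^[n + 2] h = S (S^[n + 1] h) := Function.iterate_succ_apply' S (n + 1) h
      conv_lhs => rw [e1]
      rw [hS, ← e1, ← e2]
      exact Xu.norm_ip_le _ _
    · refine (Xu.norm_le_norm1 _).trans ?_
      induction n with
      | zero => simp
      | succ n ih =>
        rw [Function.iterate_succ_apply']
        calc (S (S^[n] h)).norm1 ≤ C₂ * (C₁ * (S^[n] h).norm1) :=
              (H₂ u _).trans (mul_le_mul_of_nonneg_left (H₁ u _) hC₂)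
          _ ≤ C₂ * (C₁ * (h.norm1 * (C₂ * C₁) ^ n)) := by gcongr
          _ = h.norm1 * (C₂ * C₁) ^ (n + 1) := by ring
  rw [← Real.sqrt_sq (norm_nonneg h), ← Real.sqrt_mul (by positivity)]
  refine Real.le_sqrt_of_sq_le ?_
  rw [Xu.norm_sq, ip_regₗ]
  calc _ ≤ ‖h‖ * ‖S h‖ := Xu.norm_ip_le _ _
    _ ≤ ‖h‖ * (C₂ * C₁ * ‖h‖) := by gcongr
    _ = _ := by ring

end RegularRepresentation

section ReducedAlgebra

open FellBundle

variable {G : Type u} [ArrowGroupoid G] [TopologicalSpace G] [IsEtale G] [T2Space G]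
variable {B : G → Type v} [∀ γ, NormedAddCommGroup (B γ)] [∀ γ, NormedSpace ℂ (B γ)]
  [TopologicalSpace (TotalSpace Unit B)] [FellBundle B]

/-- `V_u(f)` as a bounded operator on `Γ_c(G_u; B) ⊆ X_u`. -/
def reg (u : Units G) (f : CcSection B) : Xu B u →L[ℂ] Xu B u :=
  (regₗ u f).mkContinuousOfExistsBound (by
    obtain ⟨C, _, hC⟩ := exists_norm_le f
    exact ⟨C, hC u⟩)

theorem reg_apply (u : Units G) (f : CcSection B) (h : Xu B u) : reg u f h = regₗ u f h := rfl

theorem reg_add (u : Units G) (f g : CcSection B) : reg u (f + g) = reg u f + reg u g :=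
  ContinuousLinearMap.ext fun h => regₗ_add f g h

theorem reg_smul (u : Units G) (z : ℂ) (f : CcSection B) : reg u (z • f) = z • reg u f :=
  ContinuousLinearMap.ext fun h => regₗ_smul z f h

theorem reg_mul (u : Units G) (f g : CcSection B) : reg u (f * g) = (reg u f).comp (reg u g) :=
  ContinuousLinearMap.ext fun h => regₗ_mul f g h

theorem bddAbove_reg (f : CcSection B) : BddAbove (Set.range fun u : Units G => ‖reg u f‖) := by
  obtain ⟨C, hC0, hC⟩ := exists_norm_le f
  refine ⟨C, ?_⟩
  rintro _ ⟨u, rfl⟩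
  exact ContinuousLinearMap.opNorm_le_bound _ hC0 (hC u)

/-- The reduced norm `‖f‖_r = sup_{u ∈ G⁽⁰⁾} ‖V_u(f)‖` on `Γ_c(G; B)`. -/
instance : Norm (CcSection B) := ⟨fun f => ⨆ u : Units G, ‖reg u f‖⟩

theorem CcSection.norm_def (f : CcSection B) : ‖f‖ = ⨆ u : Units G, ‖reg u f‖ := rfl

theorem norm_reg_le (u : Units G) (f : CcSection B) : ‖reg u f‖ ≤ ‖f‖ :=
  le_ciSup (bddAbove_reg f) u

theorem CcSection.norm_nonneg' (f : CcSection B) : 0 ≤ ‖f‖ := Real.iSup_nonneg fun _ => norm_nonneg _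

theorem CcSection.norm_le {f : CcSection B} {C : ℝ} (hC : 0 ≤ C)
    (H : ∀ u : Units G, ‖reg u f‖ ≤ C) : ‖f‖ ≤ C := Real.iSup_le H hC

theorem ccSeminormCore : SeminormedSpace.Core ℂ (CcSection B) where
  norm_nonneg f := f.norm_nonneg'
  norm_smul z f := by
    simp only [CcSection.norm_def, reg_smul, norm_smul]
    exact (Real.mul_iSup_of_nonneg (norm_nonneg z) _).symm
  norm_triangle f g := by
    refine CcSection.norm_le (add_nonneg f.norm_nonneg' g.norm_nonneg') fun u => ?_
    rw [reg_add]
    exact (norm_add_le _ _).trans (add_le_add (norm_reg_le u f) (norm_reg_le u g))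

instance : SeminormedAddCommGroup (CcSection B) := SeminormedAddCommGroup.ofCore ccSeminormCore
instance : NormedSpace ℂ (CcSection B) where
  norm_smul_le z f := (ccSeminormCore.norm_smul z f).le

theorem CcSection.norm_mul_le (f g : CcSection B) : ‖f * g‖ ≤ ‖f‖ * ‖g‖ := by
  refine CcSection.norm_le (by positivity) fun u => ?_
  rw [reg_mul]
  exact (ContinuousLinearMap.opNorm_comp_le _ _).trans
    (mul_le_mul (norm_reg_le u f) (norm_reg_le u g) (norm_nonneg _) (norm_nonneg _))

theorem CcSection.star_star' (f : CcSection B) : star (star f) = f := by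
  refine CcSection.ext fun γ => ?_
  rw [CcSection.star_apply, CcSection.star_apply]
  have key : ∀ (a b : G) (hab : b = a) (h1 : b = a⁻¹⁻¹) (h2 : a = a⁻¹⁻¹),
      adj h2 (adj (show a⁻¹ = b⁻¹ by rw [hab]) (f b)) = f a := by
    rintro a b rfl h1 h2
    exact adj_adj _ _ _
  exact key γ _ (inv_inv' γ) rfl _

theorem CcSection.star_add' (f g : CcSection B) : star (f + g) = star f + star g :=
  CcSection.ext fun _ => adj_add _ _ _

theorem CcSection.star_smul' (z : ℂ) (f : CcSection B) : star (z • f) = star z • star f :=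
  CcSection.ext fun _ => adj_smul _ _ _

theorem CcSection.norm_star_le (f : CcSection B) : ‖star f‖ ≤ ‖f‖ := by
  refine CcSection.norm_le (norm_nonneg _) fun u => ?_
  refine ContinuousLinearMap.opNorm_le_bound _ (norm_nonneg _) fun h => ?_
  have h1 : ‖reg u (star f) h‖ ^ 2 ≤ ‖f‖ * ‖reg u (star f) h‖ * ‖h‖ := by
    rw [Xu.norm_sq]
    have h2 : Xu.ip (reg u (star f) h) (reg u (star f) h)
        = Xu.ip h (reg u f (reg u (star f) h)) := by
      rw [reg_apply, ip_regₗ, CcSection.star_star']; rfl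
    rw [h2]
    calc _ ≤ ‖h‖ * ‖reg u f (reg u (star f) h)‖ := Xu.norm_ip_le _ _
      _ ≤ ‖h‖ * (‖f‖ * ‖reg u (star f) h‖) := by
          gcongr
          exact ((reg u f).le_opNorm _).trans
            (mul_le_mul_of_nonneg_right (norm_reg_le u f) (norm_nonneg _))
      _ = _ := by ring
  rcases (norm_nonneg (reg u (star f) h)).eq_or_lt with h0 | h0
  · rw [← h0]; positivity
  · refine le_of_mul_le_mul_left (a := ‖reg u (star f) h‖) ?_ h0
    calc _ = ‖reg u (star f) h‖ ^ 2 := (sq _).symm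
      _ ≤ _ := h1
      _ = _ := by ring

theorem conv_eq_sum {K : Set G} (hK : IsCompact K) (γ : G) :
    ∃ F : Finset {η : G // r η = r γ}, ∀ f : CcSection B, (∀ η ∉ K, f η = 0) →
      ∀ g : CcSection B, (f * g) γ =
        ∑ η ∈ F, mul (isProd_left η.2) (f η.1) (g (η.1⁻¹ * γ)) := by
  have hinj : Set.InjOn (fun η : {η : G // r η = r γ} => η.1) Set.univ :=
    fun a _ b _ h => Subtype.ext h
  have hfin : {η : {η : G // r η = r γ} | η.1 ∈ K}.Finite :=
    Set.Finite.of_finite_image ((finite_fibre_r hK (r γ)).subset (by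
      rintro _ ⟨η, hη, rfl⟩; exact ⟨hη, η.2⟩)) (hinj.mono (Set.subset_univ _))
  refine ⟨hfin.toFinset, fun f hf g => finsum_eq_sum_of_support_subset _ fun η hη => ?_⟩
  rw [Set.Finite.coe_toFinset]
  by_contra hc
  exact hη (mul_of_left_eq_zero _ (hf _ hc) _)

theorem CcSection.add_mul' (f f' g : CcSection B) : (f + f') * g = f * g + f' * g := by
  refine CcSection.ext fun γ => ?_
  obtain ⟨K, hK, hf⟩ := f.exists_compact
  obtain ⟨K', hK', hf'⟩ := f'.exists_compact
  obtain ⟨F, hF⟩ := conv_eq_sum (B := B) (hK.union hK') γ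
  have h1 : ∀ η ∉ K ∪ K', f η = 0 := fun η hη => hf η fun h => hη (Or.inl h)
  have h2 : ∀ η ∉ K ∪ K', f' η = 0 := fun η hη => hf' η fun h => hη (Or.inr h)
  rw [CcSection.add_apply, hF (f + f') (fun η hη => by simp [h1 η hη, h2 η hη]), hF f h1, hF f' h2,
    ← Finset.sum_add_distrib]
  exact Finset.sum_congr rfl fun η _ => FellBundle.add_mul _ _ _ _

theorem CcSection.smul_mul' (z : ℂ) (f g : CcSection B) : (z • f) * g = z • (f * g) := by
  refine CcSection.ext fun γ => ?_
  obtain ⟨K, hK, hf⟩ := f.exists_compact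
  obtain ⟨F, hF⟩ := conv_eq_sum (B := B) hK γ
  rw [CcSection.smul_apply, hF (z • f) (fun η hη => by simp [hf η hη]), hF f hf, Finset.smul_sum]
  exact Finset.sum_congr rfl fun η _ => FellBundle.smul_mul _ _ _ _

theorem CcSection.mul_add' (f g g' : CcSection B) : f * (g + g') = f * g + f * g' := by
  refine CcSection.ext fun γ => ?_
  obtain ⟨K, hK, hf⟩ := f.exists_compact
  obtain ⟨F, hF⟩ := conv_eq_sum (B := B) hK γ
  rw [CcSection.add_apply, hF f hf, hF f hf, hF f hf, ← Finset.sum_add_distrib]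
  exact Finset.sum_congr rfl fun η _ => FellBundle.mul_add _ _ _ _

theorem CcSection.mul_smul' (z : ℂ) (f g : CcSection B) : f * (z • g) = z • (f * g) := by
  refine CcSection.ext fun γ => ?_
  obtain ⟨K, hK, hf⟩ := f.exists_compact
  obtain ⟨F, hF⟩ := conv_eq_sum (B := B) hK γ
  rw [CcSection.smul_apply, hF f hf, hF f hf, Finset.smul_sum]
  exact Finset.sum_congr rfl fun η _ => FellBundle.mul_smul _ _ _ _

/-- Convolution as a bounded bilinear map. -/
def convL : CcSection B →L[ℂ] CcSection B →L[ℂ] CcSection B :=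
  (LinearMap.mk₂ ℂ (· * ·) CcSection.add_mul' CcSection.smul_mul' CcSection.mul_add'
    CcSection.mul_smul').mkContinuous₂ 1 fun f g => by
      simpa using CcSection.norm_mul_le f g

theorem convL_apply (f g : CcSection B) : convL f g = f * g := rfl

theorem ip_reg (u : Units G) (f : CcSection B) (h k : Xu B u) :
    Xu.ip (reg u f h) k = Xu.ip h (reg u (star f) k) := ip_regₗ f h k

theorem ip_reg_star (u : Units G) (f : CcSection B) (h k : Xu B u) :
    Xu.ip (reg u (star f) h) k = Xu.ip h (reg u f k) := by
  rw [ip_reg, CcSection.star_star']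

theorem Xu.ext_ip {u : Units G} {h k : Xu B u} (H : ∀ l : Xu B u, Xu.ip l h = Xu.ip l k) :
    h = k := by
  rw [← sub_eq_zero]
  refine Xu.ip_self_eq_zero _ ?_
  have : ∀ l : Xu B u, Xu.ip l (h - k) = 0 := fun l => by
    have h1 := Xu.ip_add_right l (h - k) k
    rw [sub_add_cancel, H l] at h1
    exact left_eq_add.1 (h1.trans (add_comm _ _)) 
  exact this _

theorem reg_star_mul (u : Units G) (f g : CcSection B) :
    reg u (star (f * g)) = reg u (star g * star f) := by
  refine ContinuousLinearMap.ext fun h => Xu.ext_ip fun l => ?_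
  rw [← ip_reg, reg_mul, reg_mul, ContinuousLinearMap.comp_apply, ContinuousLinearMap.comp_apply,
    ip_reg, ip_reg]

theorem CcSection.norm_sub_eq_zero {f g : CcSection B} (H : ∀ u : Units G, reg u f = reg u g) :
    ‖f - g‖ = 0 := by
  refine le_antisymm (CcSection.norm_le le_rfl fun u => ?_) (norm_nonneg _)
  have h1 := reg_add u (f - g) g
  rw [sub_add_cancel, H u] at h1
  rw [left_eq_add.1 (h1.trans (add_comm _ _)), norm_zero]

theorem CcSection.norm_star' (f : CcSection B) : ‖star f‖ = ‖f‖ :=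
  le_antisymm f.norm_star_le (by simpa [CcSection.star_star'] using (star f).norm_star_le)

/-- The C*-identity for the reduced norm. -/
theorem CcSection.norm_mul_self_le (f : CcSection B) : ‖f‖ * ‖f‖ ≤ ‖star f * f‖ := by
  rw [← sq]
  refine (Real.le_sqrt (norm_nonneg _) (norm_nonneg _)).1 ?_
  refine CcSection.norm_le (Real.sqrt_nonneg _) fun u => ?_
  refine ContinuousLinearMap.opNorm_le_bound _ (Real.sqrt_nonneg _) fun h => ?_
  rw [← Real.sqrt_sq (norm_nonneg h), ← Real.sqrt_mul (norm_nonneg _)]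
  refine Real.le_sqrt_of_sq_le ?_
  rw [Xu.norm_sq, ip_reg]
  have h1 : reg u (star f) (reg u f h) = reg u (star f * f) h := by rw [reg_mul]; rfl
  rw [h1]
  calc _ ≤ ‖h‖ * ‖reg u (star f * f) h‖ := Xu.norm_ip_le _ _
    _ ≤ ‖h‖ * (‖star f * f‖ * ‖h‖) := by
        gcongr
        exact ((reg u _).le_opNorm _).trans
          (mul_le_mul_of_nonneg_right (norm_reg_le u _) (norm_nonneg _))
    _ = _ := by ring

variable (B) in
/-- The reduced C*-algebra `C*_r(G; B)`: the completion of `Γ_c(G; B)` in the reduced norm. -/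
abbrev ReducedAlg : Type max u v := UniformSpace.Completion (CcSection B)

namespace ReducedAlg

open UniformSpace

/-- The product of `C*_r(G; B)` is the continuous extension of the convolution. -/
protected def mul : ReducedAlg B → ReducedAlg B → ReducedAlg B :=
  Function.curry <| (Completion.isDenseInducing_coe.prodMap
    Completion.isDenseInducing_coe).extend
      ((↑) ∘ Function.uncurry (fun f g : CcSection B => f * g))

/-- The involution of `C*_r(G; B)` is the continuous extension of the one of `Γ_c(G; B)`. -/
protected def star : ReducedAlg B → ReducedAlg B := Completion.map (star : CcSection B → CcSection B)

theorem continuous_conv : Continuous (fun q : CcSection B × CcSection B => q.1 * q.2) :=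
  (convL (B := B)).continuous₂

theorem coe_mul (f g : CcSection B) : ReducedAlg.mul (f : ReducedAlg B) g = ↑(f * g) :=
  (Completion.isDenseInducing_coe.prodMap Completion.isDenseInducing_coe).extend_eq
    ((Completion.continuous_coe _).comp continuous_conv) (f, g)

theorem continuous_mul :
    Continuous (fun q : ReducedAlg B × ReducedAlg B => ReducedAlg.mul q.1 q.2) := by
  let m : CcSection B →+ CcSection B →+ CcSection B :=
    AddMonoidHom.mk' (fun f => AddMonoidHom.mk' (fun g => f * g) (CcSection.mul_add' f))
      (fun f f' => AddMonoidHom.ext fun g => CcSection.add_mul' f f' g)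
  let m' := m.compr₂ (Completion.toCompl (α := CcSection B))
  have : Continuous fun p : CcSection B × CcSection B => m' p.1 p.2 :=
    (Completion.continuous_coe _).comp continuous_conv
  exact (Completion.isDenseInducing_toCompl (CcSection B)).extend_Z_bilin
    (Completion.isDenseInducing_toCompl (CcSection B)) this

theorem continuous_mul₂ {Y : Type*} [TopologicalSpace Y] {f g : Y → ReducedAlg B}
    (hf : Continuous f) (hg : Continuous g) : Continuous fun y => ReducedAlg.mul (f y) (g y) :=
  continuous_mul.comp (hf.prodMk hg)

theorem isometry_star : Isometry (star : CcSection B → CcSection B) :=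
  AddMonoidHomClass.isometry_of_norm
    (AddMonoidHom.mk' (star : CcSection B → CcSection B) CcSection.star_add') CcSection.norm_star'

theorem coe_star (f : CcSection B) : ReducedAlg.star (f : ReducedAlg B) = ↑(star f) :=
  Completion.map_coe isometry_star.uniformContinuous f

theorem continuous_star : Continuous (ReducedAlg.star : ReducedAlg B → ReducedAlg B) :=
  Completion.continuous_map

theorem coe_eq_of_reg {f g : CcSection B} (H : ∀ u : Units G, reg u f = reg u g) :
    (f : ReducedAlg B) = g := by
  rw [← sub_eq_zero, ← Completion.coe_sub, ← norm_eq_zero, Completion.norm_coe]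
  exact CcSection.norm_sub_eq_zero H

end ReducedAlg

open UniformSpace ReducedAlg in
/-- `C*_r(G; B)` is a C*-algebra. -/
instance : NonUnitalCStarAlgebra (ReducedAlg B) where
  __ := (inferInstance : NormedAddCommGroup (ReducedAlg B))
  __ := (inferInstance : NormedSpace ℂ (ReducedAlg B))
  mul := ReducedAlg.mul
  star := ReducedAlg.star
  left_distrib a b c := by
    change ReducedAlg.mul _ _ = ReducedAlg.mul _ _ + ReducedAlg.mul _ _
    refine Completion.induction_on₃ a b c (isClosed_eq ?_ ?_) fun f g h => ?_
    · exact continuous_mul₂ (by fun_prop) (by fun_prop)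
    · exact (continuous_mul₂ (by fun_prop) (by fun_prop)).add
        (continuous_mul₂ (by fun_prop) (by fun_prop))
    · rw [← Completion.coe_add, coe_mul, coe_mul, coe_mul, CcSection.mul_add', Completion.coe_add]
  right_distrib a b c := by
    change ReducedAlg.mul _ _ = ReducedAlg.mul _ _ + ReducedAlg.mul _ _
    refine Completion.induction_on₃ a b c (isClosed_eq ?_ ?_) fun f g h => ?_
    · exact continuous_mul₂ (by fun_prop) (by fun_prop)
    · exact (continuous_mul₂ (by fun_prop) (by fun_prop)).add
        (continuous_mul₂ (by fun_prop) (by fun_prop))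
    · rw [← Completion.coe_add, coe_mul, coe_mul, coe_mul, CcSection.add_mul', Completion.coe_add]
  zero_mul a := by
    change ReducedAlg.mul _ _ = _
    refine Completion.induction_on a (isClosed_eq ?_ continuous_const) fun f => ?_
    · exact continuous_mul₂ continuous_const continuous_id
    · change ReducedAlg.mul ((0 : CcSection B) : ReducedAlg B) f = ((0 : CcSection B) : ReducedAlg B)
      rw [coe_mul, ← convL_apply, map_zero, _root_.zero_apply]
  mul_zero a := by
    change ReducedAlg.mul _ _ = _
    refine Completion.induction_on a (isClosed_eq ?_ continuous_const) fun f => ?_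
    · exact continuous_mul₂ continuous_id continuous_const
    · change ReducedAlg.mul f ((0 : CcSection B) : ReducedAlg B) = ((0 : CcSection B) : ReducedAlg B)
      rw [coe_mul, ← convL_apply, map_zero]
  mul_assoc a b c := by
    change ReducedAlg.mul (ReducedAlg.mul _ _) _ = ReducedAlg.mul _ (ReducedAlg.mul _ _)
    refine Completion.induction_on₃ a b c (isClosed_eq ?_ ?_) fun f g h => ?_
    · exact continuous_mul₂ (continuous_mul₂ (by fun_prop) (by fun_prop)) (by fun_prop)
    · exact continuous_mul₂ (by fun_prop) (continuous_mul₂ (by fun_prop) (by fun_prop))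
    · rw [coe_mul, coe_mul, coe_mul, coe_mul]
      exact coe_eq_of_reg fun u => by simp only [reg_mul, ContinuousLinearMap.comp_assoc]
  norm_mul_le a b := by
    change ‖ReducedAlg.mul _ _‖ ≤ _
    refine Completion.induction_on₂ a b (isClosed_le ?_ ?_) fun f g => ?_
    · exact (continuous_mul₂ continuous_fst continuous_snd).norm
    · fun_prop
    · rw [coe_mul]
      simp only [Completion.norm_coe]
      exact CcSection.norm_mul_le f g
  star_involutive a := by
    change ReducedAlg.star (ReducedAlg.star a) = a
    have hs := ReducedAlg.continuous_star (B := B)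
    refine Completion.induction_on a (isClosed_eq (hs.comp hs) continuous_id) fun f => ?_
    rw [coe_star, coe_star, CcSection.star_star']
  star_mul a b := by
    change ReducedAlg.star (ReducedAlg.mul a b) = ReducedAlg.mul (ReducedAlg.star b) (ReducedAlg.star a)
    have hs := ReducedAlg.continuous_star (B := B)
    refine Completion.induction_on₂ a b (isClosed_eq (hs.comp (continuous_mul₂ continuous_fst continuous_snd)) ?_) fun f g => ?_
    · exact continuous_mul₂ (hs.comp continuous_snd) (hs.comp continuous_fst)
    · rw [coe_mul, coe_star, coe_star, coe_star, coe_mul]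
      exact coe_eq_of_reg fun u => reg_star_mul u f g
  star_add a b := by
    change ReducedAlg.star (a + b) = ReducedAlg.star a + ReducedAlg.star b
    have hs := ReducedAlg.continuous_star (B := B)
    refine Completion.induction_on₂ a b (isClosed_eq (hs.comp (by fun_prop)) ?_) fun f g => ?_
    · exact (hs.comp continuous_fst).add (hs.comp continuous_snd)
    · rw [← Completion.coe_add, coe_star, coe_star, coe_star, CcSection.star_add',
        Completion.coe_add]
  star_smul z a := by
    change ReducedAlg.star (z • a) = star z • ReducedAlg.star a
    have hs := ReducedAlg.continuous_star (B := B)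
    refine Completion.induction_on a (isClosed_eq (hs.comp (continuous_const_smul z))
      (hs.const_smul (star z))) fun f => ?_
    rw [← Completion.coe_smul, coe_star, coe_star, CcSection.star_smul', Completion.coe_smul]
  smul_assoc z a b := by
    change ReducedAlg.mul (z • a) b = z • ReducedAlg.mul a b
    refine Completion.induction_on₂ a b (isClosed_eq ?_ ((continuous_mul₂ continuous_fst continuous_snd).const_smul z)) fun f g => ?_
    · exact continuous_mul₂ (continuous_fst.const_smul z) continuous_snd
    · rw [← Completion.coe_smul, coe_mul, coe_mul, CcSection.smul_mul', Completion.coe_smul]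
  smul_comm z a b := by
    change z • ReducedAlg.mul a b = ReducedAlg.mul a (z • b)
    refine Completion.induction_on₂ a b (isClosed_eq ((continuous_mul₂ continuous_fst continuous_snd).const_smul z) ?_) fun f g => ?_
    · exact continuous_mul₂ continuous_fst (continuous_snd.const_smul z)
    · rw [← Completion.coe_smul, coe_mul, coe_mul, CcSection.mul_smul', Completion.coe_smul]
  toCompleteSpace := inferInstance
  norm_mul_self_le a := by
    change _ ≤ ‖ReducedAlg.mul (ReducedAlg.star a) a‖
    have hs := ReducedAlg.continuous_star (B := B)
    refine Completion.induction_on a (isClosed_le (by fun_prop)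
      (continuous_mul₂ hs continuous_id).norm) fun f => ?_
    rw [coe_star, coe_mul]
    simp only [Completion.norm_coe]
    exact CcSection.norm_mul_self_le f

theorem ReducedAlg.coe_mul' (f g : CcSection B) :
    (f : ReducedAlg B) * (g : ReducedAlg B) = ((f * g : CcSection B) : ReducedAlg B) :=
  ReducedAlg.coe_mul f g

theorem ReducedAlg.coe_star' (f : CcSection B) :
    star (f : ReducedAlg B) = ((star f : CcSection B) : ReducedAlg B) :=
  ReducedAlg.coe_star f

end ReducedAlgebra

end

end Fell

namespace Fell

noncomputable section

open scoped Topology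
open Filter Bundle ArrowGroupoid FellBundle

set_option linter.unusedSectionVars false

universe u v

/-! ### Uniform limits of sections and completeness of Γ₀. -/

section BanachBundle

variable {X : Type u} [TopologicalSpace X] {B : X → Type v}
  [∀ x, NormedAddCommGroup (B x)] [∀ x, NormedSpace ℂ (B x)]
  [TopologicalSpace (TotalSpace Unit B)] [IsBanachBundle B]

/-! The whole theorem rests on one estimate: for `f` in Γ_c the restriction of `f` to a finite
subset `F` of `G_u`, viewed as a vector of `X_u`, has norm at most `‖f‖_r`
(`CcSection.norm_restrict_le`). If `A_u` had a unit, `f` restricted to `G_u` would be `V_u(f)`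
applied to the unit placed at the point `u`. In general one puts an arbitrary `a` of `A_u` there and
gets `f(·)a`; cutting down to `F` is contractive, and a vector `x` of a Hilbert module with `‖xa‖ ≤
C‖a‖` for all `a` has norm at most `C`.

With `F` a single point this gives `‖f‖_∞ ≤ ‖f‖_r`. Since Γ₀ is complete, the inclusion of Γ_c
extends to a contraction `j` on the completion. The rule for the involution passes to the limit by
continuity.

Injectivity uses matrix coefficients. For finitely supported `h` and `k`, the element `⟨k, V_u(g)h⟩`
is a finite sum of terms `k(ζ)* g(ζτ⁻¹) h(τ)`, so it is controlled by `‖g‖_∞`, with a constant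
depending on `h` and `k`. Hence if `j(a) = 0` and `f` in Γ_c is close to `a`, every coefficient of
`V_u(f)` is at most `‖k‖ ‖f - a‖ ‖h‖`: the constant multiplies zero and drops out. Taking `k =
V_u(f)h` yields `‖f‖_r ≤ ‖f - a‖`, so `‖a‖ ≤ 2‖f - a‖`, which is arbitrarily small.

For the product, the point is a bound on the finite partial sums of the convolution at `γ` that does
not depend on the finite set. After the substitution `η = ζ⁻¹`, such a sum `z = ∑ f(ζ⁻¹) g(ζγ)`
looks like an inner product of `f*` with the translate of `g` by `γ`, except that it lies in the
fibre over `γ` and not over a unit. Multiplying by `z*` repairs this: `z z*` is an honest inner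
product in `X_{r(γ)}`, and the basic estimate bounds `‖z‖²` by `‖f‖_r ‖g‖_r ‖z‖`. For compactly
supported sections the partial sums are eventually equal to the convolution, and the uniform bound
carries convergence over to the completion. -/

theorem exists_nhds_add {x : X} (a b : B x) {W : Set (TotalSpace Unit B)}
    (hW : W ∈ 𝓝 (⟨x, a + b⟩ : TotalSpace Unit B)) :
    ∃ W₁ ∈ 𝓝 (⟨x, a⟩ : TotalSpace Unit B), ∃ W₂ ∈ 𝓝 (⟨x, b⟩ : TotalSpace Unit B),
      ∀ (y : X) (a' b' : B y), (⟨y, a'⟩ : TotalSpace Unit B) ∈ W₁ →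
        (⟨y, b'⟩ : TotalSpace Unit B) ∈ W₂ → (⟨y, a' + b'⟩ : TotalSpace Unit B) ∈ W := by
  let t : TopologicalSpace (Σ x, B x × B x) := TopologicalSpace.induced
      (fun q : (Σ x, B x × B x) =>
        ((⟨q.1, q.2.1⟩, ⟨q.1, q.2.2⟩) : TotalSpace Unit B × TotalSpace Unit B)) inferInstance
  have h1 := (IsBanachBundle.continuous_add (B := B)).continuousAt
    (x := (⟨x, (a, b)⟩ : Σ x, B x × B x)) hW
  rw [mem_map, nhds_induced, mem_comap] at h1
  obtain ⟨V, hV, hVW⟩ := h1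
  obtain ⟨W₁, h₁, W₂, h₂, hsub⟩ := mem_nhds_prod_iff.1 hV
  refine ⟨W₁, h₁, W₂, h₂, fun y a' b' ha hb => ?_⟩
  exact hVW (a := (⟨y, (a', b')⟩ : Σ x, B x × B x)) (hsub ⟨ha, hb⟩)

theorem exists_nhds_norm_sub_lt {x : X} (a b : B x) {ε : ℝ} (h : ‖a - b‖ < ε) :
    ∃ W₁ ∈ 𝓝 (⟨x, a⟩ : TotalSpace Unit B), ∃ W₂ ∈ 𝓝 (⟨x, b⟩ : TotalSpace Unit B),
      ∀ (y : X) (a' b' : B y), (⟨y, a'⟩ : TotalSpace Unit B) ∈ W₁ →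
        (⟨y, b'⟩ : TotalSpace Unit B) ∈ W₂ → ‖a' - b'‖ < ε := by
  -- Subtraction is expressed as `a + (-1) • b`, the bundle axioms being about addition and scalar
  -- multiplication.
  have hopen : {b : TotalSpace Unit B | ‖b.snd‖ < ε} ∈
      𝓝 (⟨x, a + (-1 : ℂ) • b⟩ : TotalSpace Unit B) :=
    IsBanachBundle.upperSemicontinuous_norm (B := B) _ ε (by simpa [← sub_eq_add_neg] using h)
  obtain ⟨W₁, h₁, W₂, h₂, H⟩ := exists_nhds_add a _ hopen
  refine ⟨W₁, h₁, _, (IsBanachBundle.continuous_smul (B := B) (-1)).continuousAt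
    (x := (⟨x, b⟩ : TotalSpace Unit B)) h₂, fun y a' b' ha hb => ?_⟩
  simpa [← sub_eq_add_neg] using H y a' _ ha hb

/-- Because the projection is open, every `y` near `x` carries some vector `c` close to `f x` in the
total space. Upper semicontinuity of the norm, applied to the difference with a continuous
approximant `g`, makes `‖f y - c‖` small. So `f y` is `c` plus a small vector, and it is close to `f
x + 0` by continuity of addition and the axiom on neighbourhoods of zero vectors. The choice of `c`
need not be continuous in `y`. -/
theorem continuous_of_uniform_approx {f : ∀ x, B x}
    (H : ∀ ε > 0, ∃ g : ∀ x, B x, Continuous (toTotal g) ∧ ∀ x, ‖f x - g x‖ < ε) :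
    Continuous (toTotal f) := by
  refine continuous_iff_continuousAt.2 fun x W hW => ?_
  have hW' : W ∈ 𝓝 (⟨x, 0 + f x⟩ : TotalSpace Unit B) := by rwa [zero_add]
  obtain ⟨W₁, h₁, W₂, h₂, hadd⟩ := exists_nhds_add _ _ hW'
  obtain ⟨S, hS, T, hT, hST⟩ := mem_inf_iff_superset.1 (IsBanachBundle.tendsto_zero (B := B) x h₁)
  obtain ⟨N, hN, hNS⟩ := mem_comap.1 hS
  obtain ⟨D, hD, hDT⟩ := mem_comap.1 hT
  obtain ⟨ε, hε, hεD⟩ := Metric.mem_nhds_iff.1 hD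
  obtain ⟨g, hg, hfg⟩ := H (ε / 2) (half_pos hε)
  obtain ⟨W₃, h₃, W₄, h₄, hsub⟩ := exists_nhds_norm_sub_lt (f x) (g x) (hfg x)
  -- The base points of the neighbourhood `W₂ ∩ W₃` of `f x` form a neighbourhood of `x`; this
  -- supplies `c` over each nearby `y`.
  have himg := (IsBanachBundle.isOpenMap_proj (B := B)).image_mem_nhds (inter_mem h₂ h₃)
  change ∀ᶠ y in 𝓝 x, toTotal f y ∈ W
  filter_upwards [himg, hN, (hg.tendsto x).eventually_mem h₄] with y hy hyN hyg
  obtain ⟨⟨y, c⟩, ⟨hc₂, hc₃⟩, rfl⟩ := hy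
  have hlt : ‖f y - c‖ < ε := by
    have := hsub y c (g y) hc₃ hyg
    calc ‖f y - c‖ = ‖(f y - g y) - (c - g y)‖ := by congr 1; abel
      _ ≤ ‖f y - g y‖ + ‖c - g y‖ := norm_sub_le _ _
      _ < ε := by linarith [hfg y]
  have hmem : (⟨y, f y - c⟩ : TotalSpace Unit B) ∈ W₁ :=
    hST ⟨hNS hyN, hDT (hεD (by simpa using hlt))⟩
  have := hadd y _ c hmem hc₂
  rwa [sub_add_cancel] at this

/-- Closedness in the complete space of bounded sections makes Γ₀ complete, which is needed to
extend the inclusion of Γ_c to the completion. -/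
theorem isClosed_c0Section : IsClosed (C0Section B : Set (lp B ⊤)) := by
  rw [← isSeqClosed_iff_isClosed]
  intro F f hF hf
  have happ : ∀ ε > 0, ∃ g ∈ C0Section B, ∀ x, ‖f x - g x‖ < ε := fun ε hε => by
    obtain ⟨n, hn⟩ := (Metric.tendsto_atTop.1 hf ε hε)
    refine ⟨F n, hF n, fun x => ?_⟩
    have h1 := hn n le_rfl
    rw [dist_comm, dist_eq_norm] at h1
    exact (lp.norm_apply_le_norm ENNReal.top_ne_zero (f - F n) x).trans_lt h1
  refine ⟨continuous_of_uniform_approx fun ε hε => ?_, ?_⟩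
  · obtain ⟨g, hg, h⟩ := happ ε hε
    exact ⟨g, hg.1, h⟩
  · rw [Metric.tendsto_nhds]
    intro ε hε
    obtain ⟨g, hg, h⟩ := happ (ε / 2) (half_pos hε)
    filter_upwards [hg.2.eventually_lt_const (half_pos hε)] with x hx
    rw [dist_zero_right, norm_norm]
    calc ‖f x‖ = ‖(f x - g x) + g x‖ := by rw [sub_add_cancel]
      _ ≤ _ := norm_add_le _ _
      _ < ε := by linarith [h x]

instance : CompleteSpace (C0Section B) :=
  haveI : ∀ x, CompleteSpace (B x) := IsBanachBundle.completeSpace (B := B)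
  isClosed_c0Section.completeSpace_coe

theorem C0Section.norm_apply_le (f : C0Section B) (x : X) : ‖f x‖ ≤ ‖f‖ :=
  lp.norm_apply_le_norm ENNReal.top_ne_zero f.1 x

theorem C0Section.continuous_eval (x : X) : Continuous fun f : C0Section B => f x := by
  let e : C0Section B →ₗ[ℂ] B x :=
    { toFun := fun f => f x, map_add' := fun _ _ => rfl, map_smul' := fun _ _ => rfl }
  exact (e.mkContinuous 1 fun f => by
    rw [one_mul]; exact C0Section.norm_apply_le f x).continuous

theorem CcSection.tendsto_norm_cocompact (f : CcSection B) :
    Tendsto (fun x => ‖f x‖) (cocompact X) (𝓝 0) := by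
  obtain ⟨K, hK, hf⟩ := f.exists_compact
  refine tendsto_const_nhds.congr' ?_
  filter_upwards [hK.compl_mem_cocompact] with x hx
  rw [hf x hx, norm_zero]

/-- The inclusion of `Γ_c(X; B)` into `Γ₀(X; B)`. -/
def CcSection.toC0 : CcSection B →ₗ[ℂ] C0Section B where
  toFun f := ⟨⟨f.toFun, memℓp_of_vanishing f.continuous f.tendsto_norm_cocompact⟩,
    f.continuous, f.tendsto_norm_cocompact⟩
  map_add' _ _ := rfl
  map_smul' _ _ := rfl

end BanachBundle

/-! ### Vectors of `X_u`: restriction to finite sets, norm test, right translation. -/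

section Restriction

variable {G : Type u} [ArrowGroupoid G] [TopologicalSpace G]
variable {B : G → Type v} [∀ γ, NormedAddCommGroup (B γ)] [∀ γ, NormedSpace ℂ (B γ)]
  [TopologicalSpace (TotalSpace Unit B)] [FellBundle B] {u : Units G}

open Classical in
/-- The function on `G_u` which agrees with `h` on the finite set `F` and vanishes elsewhere. -/
def Xu.restrict (F : Finset {η : G // s η = u.1}) (h : ∀ η : {η : G // s η = u.1}, B η.1) :
    Xu B u :=
  Xu.mk (fun η => if η ∈ F then h η else 0) (F.finite_toSet.subset fun η hη => by
    by_contra hc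
    exact hη (if_neg hc))

theorem Xu.restrict_apply_mem {F : Finset {η : G // s η = u.1}}
    (h : ∀ η : {η : G // s η = u.1}, B η.1) {η} (hη : η ∈ F) : Xu.restrict F h η = h η :=
  if_pos hη

theorem Xu.restrict_apply_notMem {F : Finset {η : G // s η = u.1}}
    (h : ∀ η : {η : G // s η = u.1}, B η.1) {η} (hη : η ∉ F) : Xu.restrict F h η = 0 :=
  if_neg hη

theorem Xu.supp_restrict_subset (F : Finset {η : G // s η = u.1})
    (h : ∀ η : {η : G // s η = u.1}, B η.1) : (Xu.restrict F h).supp ⊆ F := fun η hη => by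
  by_contra hc
  exact (Xu.mem_supp _ η).1 hη (Xu.restrict_apply_notMem h hc)

/-- Restriction is an orthogonal projection: pairing the restriction with itself or with `h` gives
the same element, and Cauchy–Schwarz concludes. -/
theorem Xu.norm_restrict_le (F : Finset {η : G // s η = u.1}) (h : Xu B u) :
    ‖Xu.restrict F h‖ ≤ ‖h‖ := by
  have h1 : Xu.ip (Xu.restrict F h) (Xu.restrict F h) = Xu.ip (Xu.restrict F h) h := by
    rw [Xu.ip_eq _ _ F (Or.inl (Xu.supp_restrict_subset F h)),
      Xu.ip_eq _ _ F (Or.inl (Xu.supp_restrict_subset F h))]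
    exact Finset.sum_congr rfl fun η hη => by rw [Xu.restrict_apply_mem _ hη]
  rcases (norm_nonneg (Xu.restrict F h)).eq_or_lt with h0 | h0
  · rw [← h0]; exact norm_nonneg h
  · refine le_of_mul_le_mul_left ?_ h0
    rw [← sq, Xu.norm_sq, h1]
    exact Xu.norm_ip_le _ _

theorem Xu.norm_restrict_singleton (η : {η : G // s η = u.1})
    (h : ∀ η : {η : G // s η = u.1}, B η.1) : ‖Xu.restrict {η} h‖ = ‖h η‖ := by
  rw [← sq_eq_sq₀ (norm_nonneg _) (norm_nonneg _), Xu.norm_sq,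
    Xu.ip_eq _ _ {η} (Or.inl (Xu.supp_restrict_subset _ h)), Finset.sum_singleton,
    Xu.restrict_apply_mem h (Finset.mem_singleton_self η), norm_adj_mul_self]

theorem Xu.norm_ip_self_sq (h : Xu B u) :
    ‖mul (isProd_unit u) (Xu.ip h h) (Xu.ip h h)‖ = ‖Xu.ip h h‖ ^ 2 := by
  -- The inner product of `h` with itself is self-adjoint, so its square has the form to which the
  -- C*-identity applies.
  conv_lhs => enter [1, 2]; rw [← Xu.adj_ip h h]
  exact norm_adj_mul_self' _ _ _

/-- An element `x` of `X_u` has norm at most `C` if `‖x a‖ ≤ C ‖a‖` for all `a` in `A_u`. -/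
theorem Xu.norm_le_of_act {h : Xu B u} {C : ℝ} (hC : 0 ≤ C) (H : ∀ a : B u.1, ‖h.act a‖ ≤ C * ‖a‖) :
    ‖h‖ ≤ C := by
  -- The hypothesis is tested on the single element `a = ⟨h, h⟩`. In terms of `‖h‖` the resulting
  -- inequality reads `‖h‖⁴ ≤ C ‖h‖³`, and no approximate unit is required.
  have h1 : ‖Xu.ip h h‖ ^ 2 ≤ ‖h‖ * (C * ‖Xu.ip h h‖) := by
    rw [← Xu.norm_ip_self_sq, ← Xu.ip_act_right]
    exact (Xu.norm_ip_le _ _).trans (mul_le_mul_of_nonneg_left (H _) (norm_nonneg _))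
  rw [← Xu.norm_sq] at h1
  rcases (norm_nonneg h).eq_or_lt with h0 | h0
  · rwa [← h0]
  · refine le_of_mul_le_mul_left (a := ‖h‖ ^ 3) ?_ (by positivity)
    calc ‖h‖ ^ 3 * ‖h‖ = (‖h‖ ^ 2) ^ 2 := by ring
      _ ≤ _ := h1
      _ = _ := by ring

/-- The bijection `ζ ↦ ζγ` from `G_{r(γ)}` to `G_{s(γ)}`. -/
def translate {w : Units G} {γ : G} (hs : s γ = u.1) (hr : r γ = w.1) :
    {ζ : G // s ζ = w.1} ≃ {η : G // s η = u.1} where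
  toFun ζ := ⟨ζ.1 * γ, by rw [s_mul (ζ.2.trans hr.symm), hs]⟩
  invFun η := ⟨η.1 * γ⁻¹, by rw [s_mul (by rw [r_inv, hs, η.2]), s_inv, hr]⟩
  left_inv ζ := Subtype.ext (mul_inv_cancel_right' (ζ.2.trans hr.symm))
  right_inv η := Subtype.ext (inv_mul_cancel_right' (η.2.trans hs.symm))

theorem isProd_translate {w : Units G} {γ : G} (hs : s γ = u.1) (hr : r γ = w.1)
    (ζ : {ζ : G // s ζ = w.1}) : IsProd (translate hs hr ζ).1 γ⁻¹ ζ.1 :=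
  ⟨by rw [(translate hs hr ζ).2, r_inv, hs], mul_inv_cancel_right' (ζ.2.trans hr.symm)⟩

/-- Right multiplication `X_{s(γ)} × B(γ⁻¹) → X_{r(γ)}`, `(h · c)(ζ) = h(ζγ) c`. -/
def Xu.actArrow {w : Units G} {γ : G} (hs : s γ = u.1) (hr : r γ = w.1) (h : Xu B u) (c : B γ⁻¹) :
    Xu B w :=
  Xu.mk (fun ζ => mul (isProd_translate hs hr ζ) (h (translate hs hr ζ)) c) (by
    refine Set.Finite.subset (h.finite.preimage (translate hs hr).injective.injOn) fun ζ hζ hc => ?_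
    exact hζ (mul_of_left_eq_zero _ hc _))

/-- Reindexing by `ζ ↦ ζγ` shows that the inner product of `h · c` with itself is `c* ⟨h, h⟩ c`,
whose norm is at most `‖h‖² ‖c‖²`. -/
theorem Xu.norm_actArrow_le {w : Units G} {γ : G} (hs : s γ = u.1) (hr : r γ = w.1) (h : Xu B u)
    (c : B γ⁻¹) : ‖h.actArrow hs hr c‖ ≤ ‖h‖ * ‖c‖ := by
  classical
  have hS : (h.actArrow hs hr c).supp ⊆ h.supp.map (translate hs hr).symm.toEmbedding := by
    intro ζ hζ
    rw [Finset.mem_map_equiv, Equiv.symm_symm, Xu.mem_supp]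
    intro hc
    exact (Xu.mem_supp _ ζ).1 hζ (mul_of_left_eq_zero _ hc _)
  -- The two products in which `c* (⟨h, h⟩ c)` is formed: `c` lies over `γ⁻¹`, whose range is `u`,
  -- and `c*` lies over `γ`.
  have p1 : IsProd u.1 γ⁻¹ γ⁻¹ :=
    ⟨by rw [s_unit, r_inv, hs], by rw [← hs, ← r_inv, range_mul]⟩
  have p2 : IsProd γ γ⁻¹ w.1 := ⟨(r_inv γ).symm, by rw [self_mul_inv, hr]⟩
  have key : Xu.ip (h.actArrow hs hr c) (h.actArrow hs hr c)
      = mul p2 (adj (inv_inv' γ).symm c) (mul p1 (Xu.ip h h) c) := by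
    rw [Xu.ip_eq _ _ _ (Or.inl hS), Finset.sum_map, Xu.ip_eq h h h.supp (Or.inl subset_rfl),
      FellBundle.sum_mul, FellBundle.mul_sum]
    refine Finset.sum_congr rfl fun η _ => ?_
    obtain ⟨ζ, rfl⟩ := (translate hs hr).surjective η
    rw [Equiv.coe_toEmbedding, Equiv.symm_apply_apply]
    have p := isProd_translate hs hr ζ
    have p' : IsProd γ (translate hs hr ζ).1⁻¹ ζ.1⁻¹ := by simpa only [inv_inv'] using p.inv
    have q : IsProd (translate hs hr ζ).1⁻¹ ζ.1 γ⁻¹ :=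
      ⟨by rw [s_inv, p.r_eq], eq_inv_mul p⟩
    change mul _ (adj rfl (mul p (h (translate hs hr ζ)) c)) (mul p (h (translate hs hr ζ)) c) = _
    rw [adj_mul p p' rfl (inv_inv' γ).symm rfl, FellBundle.mul_assoc p' _ q p2,
      FellBundle.mul_assoc (isProd_inv (translate hs hr ζ).2) p1 p q]
  refine (sq_le_sq₀ (norm_nonneg _) (by positivity)).1 ?_
  rw [Xu.norm_sq, key, mul_pow, Xu.norm_sq]
  calc _ ≤ ‖adj (inv_inv' γ).symm c‖ * (‖Xu.ip h h‖ * ‖c‖) :=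
        (FellBundle.norm_mul_le _ _ _).trans
          (mul_le_mul_of_nonneg_left (FellBundle.norm_mul_le _ _ _) (norm_nonneg _))
    _ = _ := by rw [norm_adj]; ring

end Restriction

/-! ### Estimates for compactly supported sections by the reduced norm. -/

section Bounds

variable {G : Type u} [ArrowGroupoid G] [TopologicalSpace G] [IsEtale G] [T2Space G]
variable {B : G → Type v} [∀ γ, NormedAddCommGroup (B γ)] [∀ γ, NormedSpace ℂ (B γ)]
  [TopologicalSpace (TotalSpace Unit B)] [FellBundle B]

/-- `V_u(f)` sends the vector with value `a` at `u` and zero elsewhere to the function `ζ ↦ f(ζ) a`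
on `G_u`. Restricting to `F` does not increase the norm, so the restriction of `f`, multiplied by
`a`, has norm at most `‖f‖ ‖a‖`. As `a` is arbitrary, `Xu.norm_le_of_act` removes it. -/
theorem CcSection.norm_restrict_le (f : CcSection B) (u : Units G)
    (F : Finset {η : G // s η = u.1}) : ‖Xu.restrict F fun η => f η.1‖ ≤ ‖f‖ := by
  classical
  refine Xu.norm_le_of_act (norm_nonneg f) fun a => ?_
  -- The point `τ` is the unit `u` regarded as an arrow in `G_u`; the test vector is `a`
  -- concentrated there.
  let τ : {η : G // s η = u.1} := ⟨u.1, s_unit u⟩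
  let p : ∀ η : {η : G // s η = u.1}, B η.1 :=
    Pi.single (M := fun η : {η : G // s η = u.1} => B η.1) τ a
  have hp : p τ = a :=
    Pi.single_eq_same (M := fun η : {η : G // s η = u.1} => B η.1) τ a
  have hτ : Xu.restrict {τ} p τ = a :=
    (Xu.restrict_apply_mem p (Finset.mem_singleton_self τ)).trans hp
  have hd : ‖Xu.restrict {τ} p‖ = ‖a‖ := by rw [Xu.norm_restrict_singleton, hp]
  have h1 : (Xu.restrict F fun η => f η.1).act a
      = Xu.restrict F (reg u f (Xu.restrict {τ} p)) := by
    refine Xu.ext fun ζ => ?_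
    change mul _ _ _ = _
    by_cases hζ : ζ ∈ F
    · rw [Xu.restrict_apply_mem _ hζ, Xu.restrict_apply_mem _ hζ, reg_apply,
        regₗ_eq _ _ ζ {τ} (Xu.supp_restrict_subset _ p), Finset.sum_singleton, hτ]
      refine mul_congr_left (fun γ => f γ) ?_ _ _ _
      change ζ.1 = ζ.1 * u.1⁻¹
      rw [inv_unit]
      conv_lhs => rw [← mul_source ζ.1, ζ.2]
    · rw [Xu.restrict_apply_notMem _ hζ, Xu.restrict_apply_notMem _ hζ, FellBundle.zero_mul]
  rw [h1]
  refine (Xu.norm_restrict_le F _).trans (((reg u f).le_opNorm _).trans ?_)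
  rw [hd]
  exact mul_le_mul_of_nonneg_right (norm_reg_le u f) (norm_nonneg a)

/-- The case of a one-point set `F`, where the norm of `X_u` is that of the fibre. -/
theorem CcSection.norm_apply_le (f : CcSection B) (γ : G) : ‖f γ‖ ≤ ‖f‖ := by
  have h := f.norm_restrict_le ⟨s γ, r_s γ⟩ {⟨γ, rfl⟩}
  rwa [Xu.norm_restrict_singleton] at h

theorem isProd_inv_left {γ ζ : G} (h : s ζ = r γ) : IsProd ζ⁻¹ (ζ * γ) γ :=
  ⟨by rw [s_inv, r_mul h], inv_mul_cancel_left' h⟩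

/-- The sum `z` lies over `γ`, so it is not itself an inner product, but `z z*` is: it pairs `f*`,
cut down to `F`, with the right translate by `z*` of `g`, cut down to `Fγ`. Cauchy–Schwarz and
`CcSection.norm_restrict_le` bound `‖z‖²` by `‖f‖ ‖g‖ ‖z‖`. Summing over arrows with source `r γ`
places the vectors in the modules `X_u`. -/
theorem CcSection.norm_sum_inv_mul_le (f g : CcSection B) (γ : G)
    (F : Finset {ζ : G // s ζ = (rangeUnit γ).1}) :
    ‖∑ ζ ∈ F, mul (isProd_inv_left ζ.2) (f ζ.1⁻¹) (g (ζ.1 * γ))‖ ≤ ‖f‖ * ‖g‖ := by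
  set z : B γ := ∑ ζ ∈ F, mul (isProd_inv_left ζ.2) (f ζ.1⁻¹) (g (ζ.1 * γ)) with hz
  let u : Units G := ⟨s γ, r_s γ⟩
  have hs : s γ = u.1 := rfl
  have hr : r γ = (rangeUnit γ).1 := rfl
  -- Since `x(ζ)* = f(ζ⁻¹)` on `F` and `y(ζγ) = g(ζγ)` there, the terms of `⟨x, y · z*⟩` are those
  -- of `z` multiplied on the right by `z*`.
  let x : Xu B (rangeUnit γ) := Xu.restrict F fun ζ => (star f) ζ.1
  let y : Xu B u := Xu.restrict (F.map (translate hs hr).toEmbedding) fun η => g η.1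
  have p2 : IsProd γ γ⁻¹ (rangeUnit γ).1 := ⟨(r_inv γ).symm, self_mul_inv γ⟩
  have hip : Xu.ip x (y.actArrow hs hr (adj rfl z)) = mul p2 z (adj rfl z) := by
    rw [Xu.ip_eq _ _ F (Or.inl (Xu.supp_restrict_subset _ _))]
    conv_rhs => enter [2]; rw [hz]
    rw [FellBundle.sum_mul]
    refine Finset.sum_congr rfl fun ζ hζ => ?_
    have hy : y (translate hs hr ζ) = g (translate hs hr ζ).1 :=
      Xu.restrict_apply_mem _ (Finset.mem_map_of_mem _ hζ)
    change mul _ (adj rfl (x ζ)) (mul (isProd_translate hs hr ζ) (y (translate hs hr ζ)) _) = _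
    rw [hy, Xu.restrict_apply_mem _ hζ, CcSection.star_apply, adj_adj]
    exact (FellBundle.mul_assoc _ _ _ _ _ _ _).symm
  -- This is the C*-identity for `z*` in place of `z`, combined with the isometry of the involution.
  have hnorm : ‖mul p2 z (adj rfl z)‖ = ‖z‖ ^ 2 := by
    have := norm_adj_mul_self' (inv_inv' γ).symm p2 (adj rfl z)
    rwa [adj_adj, norm_adj] at this
  have hle : ‖z‖ ^ 2 ≤ ‖f‖ * (‖g‖ * ‖z‖) := by
    rw [← hnorm, ← hip]
    refine (Xu.norm_ip_le _ _).trans (mul_le_mul ?_ ?_ (norm_nonneg _) (norm_nonneg _))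
    · exact ((star f).norm_restrict_le _ F).trans f.norm_star_le
    · refine (Xu.norm_actArrow_le hs hr y _).trans ?_
      rw [norm_adj]
      exact mul_le_mul_of_nonneg_right (g.norm_restrict_le _ _) (norm_nonneg _)
  rcases (norm_nonneg z).eq_or_lt with h0 | h0
  · rw [← h0]; positivity
  · refine le_of_mul_le_mul_right (a := ‖z‖) ?_ h0
    calc ‖z‖ * ‖z‖ = ‖z‖ ^ 2 := (sq _).symm
      _ ≤ _ := hle
      _ = _ := by ring

/-- All finite partial sums of a convolution are bounded by the product of the reduced norms. -/
theorem CcSection.norm_sum_mul_le (f g : CcSection B) (γ : G) (F : Finset {η : G // r η = r γ}) :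
    ‖∑ η ∈ F, mul (isProd_left η.2) (f η.1) (g (η.1⁻¹ * γ))‖ ≤ ‖f‖ * ‖g‖ := by
  -- Inversion turns the range fibre at `r γ` into the source fibre, where the preceding estimate
  -- lives.
  let e : {η : G // r η = r γ} ↪ {ζ : G // s ζ = (rangeUnit γ).1} :=
    ⟨fun η => ⟨η.1⁻¹, (s_inv η.1).trans η.2⟩, fun a b hab => Subtype.ext (by
      have h : a.1⁻¹ = b.1⁻¹ := congrArg Subtype.val hab
      rw [← inv_inv' a.1, h, inv_inv'])⟩
  have h := f.norm_sum_inv_mul_le g γ (F.map e)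
  rw [Finset.sum_map] at h
  convert h using 3 with η
  exact mul_congr_left (fun γ => f γ) (inv_inv' η.1).symm _ _ _

end Bounds

/-! ### The map `j`: construction, involution, injectivity. -/

section Embedding

variable {G : Type u} [ArrowGroupoid G] [TopologicalSpace G] [IsEtale G] [T2Space G]
variable {B : G → Type v} [∀ γ, NormedAddCommGroup (B γ)] [∀ γ, NormedSpace ℂ (B γ)]
  [TopologicalSpace (TotalSpace Unit B)] [FellBundle B]

open UniformSpace

theorem CcSection.norm_toC0_le (f : CcSection B) : ‖CcSection.toC0 f‖ ≤ ‖f‖ :=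
  lp.norm_le_of_forall_le (norm_nonneg f) f.norm_apply_le

/-- The map `j : C*_r(G; B) → Γ₀(G; B)` extending the inclusion of `Γ_c(G; B)`. -/
def ReducedAlg.toC0 : ReducedAlg B →L[ℂ] C0Section B :=
  LinearMap.extendOfNorm CcSection.toC0
    (Completion.toComplL (𝕜 := ℂ) (E := CcSection B)).toLinearMap

namespace ReducedAlg

theorem toC0_coe (f : CcSection B) : toC0 (f : ReducedAlg B) = CcSection.toC0 f :=
  LinearMap.extendOfNorm_eq (e := (Completion.toComplL (𝕜 := ℂ) (E := CcSection B)).toLinearMap)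
    Completion.denseRange_coe
    ⟨1, fun f => by
      rw [one_mul]; exact f.norm_toC0_le.trans (Completion.norm_coe f).ge⟩ f

theorem norm_toC0_le (a : ReducedAlg B) : ‖toC0 a‖ ≤ ‖a‖ := by
  refine Completion.induction_on a (isClosed_le (by fun_prop) (by fun_prop)) fun f => ?_
  rw [toC0_coe, Completion.norm_coe]
  exact f.norm_toC0_le

theorem continuous_toC0_apply (γ : G) : Continuous fun a : ReducedAlg B => toC0 a γ :=
  (C0Section.continuous_eval γ).comp toC0.continuous

/-- Continuity here refers to the norms of the fibres and comes from isometry, not from the topology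
of the total space. -/
theorem continuous_adj_fibre {γ δ : G} (h : δ = γ⁻¹) : Continuous (adj h : B γ → B δ) :=
  (AddMonoidHomClass.isometry_of_norm (AddMonoidHom.mk' (adj h : B γ → B δ) (adj_add h))
    (norm_adj h)).continuous

theorem continuous_mul_fibre {γ η ζ : G} (h : IsProd γ η ζ) {Y : Type*} [TopologicalSpace Y]
    {f : Y → B γ} {g : Y → B η} (hf : Continuous f) (hg : Continuous g) :
    Continuous fun y => mul h (f y) (g y) := by
  have := ((mulₗ (B := B) h).mkContinuous₂ 1 fun a b => by
    rw [one_mul]; exact FellBundle.norm_mul_le h a b).continuous₂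
  exact this.comp (hf.prodMk hg)

theorem toC0_star (a : ReducedAlg B) (γ : G) :
    toC0 (star a) γ = adj (inv_inv' γ).symm (toC0 a γ⁻¹) := by
  refine Completion.induction_on a (isClosed_eq ((continuous_toC0_apply γ).comp continuous_star)
    ((continuous_adj_fibre _).comp (continuous_toC0_apply γ⁻¹))) fun f => ?_
  rw [coe_star', toC0_coe, toC0_coe]
  rfl

/-- The coefficient is a finite sum of terms `k(ζ)* g(ζτ⁻¹) h(τ)`. For fixed `h` and `k` it is
therefore continuous in `g` for the supremum norm; the ℓ¹-norms serve only as a finite constant. -/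
theorem norm_ip_regₗ_le (u : Units G) (g : CcSection B) (h k : Xu B u) :
    ‖Xu.ip k (regₗ u g h)‖ ≤ k.norm1 * h.norm1 * ‖CcSection.toC0 g‖ := by
  rw [Xu.ip_eq k _ k.supp (Or.inl subset_rfl)]
  calc _ ≤ ∑ ζ ∈ k.supp, ‖k ζ‖ * (h.norm1 * ‖CcSection.toC0 g‖) := by
        refine (norm_sum_le _ _).trans (Finset.sum_le_sum fun ζ _ => ?_)
        refine (FellBundle.norm_mul_le _ _ _).trans ?_
        rw [norm_adj]
        refine mul_le_mul_of_nonneg_left ?_ (norm_nonneg _)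
        rw [regₗ_eq g h ζ h.supp subset_rfl, Xu.norm1, Finset.sum_mul]
        refine (norm_sum_le _ _).trans (Finset.sum_le_sum fun τ _ => ?_)
        refine (FellBundle.norm_mul_le _ _ _).trans ?_
        rw [mul_comm]
        exact mul_le_mul_of_nonneg_left
          (C0Section.norm_apply_le (CcSection.toC0 g) _) (norm_nonneg _)
    _ = _ := by rw [← Finset.sum_mul, ← _root_.mul_assoc]; rfl

/-- The matrix coefficients of `V_u(f)` are controlled by the distance of `f` to `a` and by the
supremum norm of `j(a)`. -/
theorem norm_ip_reg_le (u : Units G) (f : CcSection B) (h k : Xu B u) (a : ReducedAlg B) :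
    ‖Xu.ip k (reg u f h)‖ ≤
      ‖k‖ * (‖(f : ReducedAlg B) - a‖ * ‖h‖) + k.norm1 * h.norm1 * ‖toC0 a‖ := by
  -- Both sides are continuous in `a`, so `a` may be taken to be some `g` in Γ_c, and then `V_u(f) =
  -- V_u(f - g) + V_u(g)`.
  refine Completion.induction_on a (isClosed_le continuous_const (by fun_prop)) fun g => ?_
  have h1 : reg u f h = reg u (f - g) h + regₗ u g h := by
    rw [← reg_apply, ← add_apply, ← reg_add, sub_add_cancel]
  rw [h1, Xu.ip_add_right, ← Completion.coe_sub, Completion.norm_coe, toC0_coe]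
  refine (norm_add_le _ _).trans (add_le_add ?_ (norm_ip_regₗ_le u g h k))
  refine (Xu.norm_ip_le _ _).trans (mul_le_mul_of_nonneg_left ?_ (norm_nonneg _))
  exact ((reg u (f - g)).le_opNorm h).trans
    (mul_le_mul_of_nonneg_right (norm_reg_le u _) (norm_nonneg _))

/-- When `j(a) = 0` the ℓ¹ term of `norm_ip_reg_le` vanishes however large its constant is, leaving
a bound on the coefficients of `V_u(f)` by Hilbert module norms alone. In this way `V_u` need not be
extended to the completion. -/
theorem norm_le_norm_sub_of_toC0_eq_zero {a : ReducedAlg B} (ha : toC0 a = 0) (f : CcSection B) :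
    ‖f‖ ≤ ‖(f : ReducedAlg B) - a‖ := by
  refine CcSection.norm_le (norm_nonneg _) fun u => ?_
  refine ContinuousLinearMap.opNorm_le_bound _ (norm_nonneg _) fun h => ?_
  -- With `k = V_u(f)h` the coefficient has norm `‖V_u(f)h‖²`, and one factor cancels.
  have h1 := norm_ip_reg_le u f h (reg u f h) a
  rw [ha, norm_zero, MulZeroClass.mul_zero, add_zero, ← Xu.norm_sq, sq] at h1
  rcases (norm_nonneg (reg u f h)).eq_or_lt with h0 | h0
  · rw [← h0]; positivity
  · exact le_of_mul_le_mul_left h1 h0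

/-- For `f` within `ε/2` of a kernel element `a`, one has `‖a‖ ≤ ‖a - f‖ + ‖f‖ ≤ 2‖f - a‖ < ε`. -/
theorem toC0_injective : Function.Injective (toC0 : ReducedAlg B → C0Section B) := by
  refine (injective_iff_map_eq_zero (toC0 (B := B))).2 fun a ha => ?_
  rw [← norm_le_zero_iff]
  refine le_of_forall_pos_le_add fun ε hε => ?_
  obtain ⟨f, hf⟩ := Completion.denseRange_coe.exists_dist_lt a (half_pos hε)
  have h1 := norm_le_norm_sub_of_toC0_eq_zero ha f
  rw [dist_comm, dist_eq_norm] at hf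
  have h2 := norm_le_norm_add_norm_sub' a (f : ReducedAlg B)
  rw [Completion.norm_coe, norm_sub_rev] at h2
  linarith

/-! ### Convergence of the convolution series on the completion. -/

/-- The partial sum over `F` of the convolution of `j(a)` and `j(b)` at `γ`. -/
def partialConv (γ : G) (F : Finset {η : G // r η = r γ}) (a b : ReducedAlg B) : B γ :=
  ∑ η ∈ F, mul (isProd_left η.2) (toC0 a η.1) (toC0 b (η.1⁻¹ * γ))

/-- For fixed `F` only finitely many evaluations occur, so the bound passes from Γ_c to the
completion by density. It is independent of `F`, which is what allows limits to be interchanged. -/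
theorem norm_partialConv_le (γ : G) (F : Finset {η : G // r η = r γ}) (a b : ReducedAlg B) :
    ‖partialConv γ F a b‖ ≤ ‖a‖ * ‖b‖ := by
  refine Completion.induction_on₂ a b (isClosed_le (Continuous.norm ?_) (by fun_prop))
    fun f g => ?_
  · exact continuous_finsetSum _ fun η _ => continuous_mul_fibre _
      ((continuous_toC0_apply _).comp continuous_fst) ((continuous_toC0_apply _).comp continuous_snd)
  · rw [Completion.norm_coe, Completion.norm_coe, partialConv, toC0_coe, toC0_coe]
    exact f.norm_sum_mul_le g γ F

theorem partialConv_add_left (γ : G) (F : Finset {η : G // r η = r γ}) (a a' b : ReducedAlg B) :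
    partialConv γ F (a + a') b = partialConv γ F a b + partialConv γ F a' b := by
  simp only [partialConv, map_add, ← Finset.sum_add_distrib]
  exact Finset.sum_congr rfl fun η _ => FellBundle.add_mul _ _ _ _

theorem partialConv_add_right (γ : G) (F : Finset {η : G // r η = r γ}) (a b b' : ReducedAlg B) :
    partialConv γ F a (b + b') = partialConv γ F a b + partialConv γ F a b' := by
  simp only [partialConv, map_add, ← Finset.sum_add_distrib]
  exact Finset.sum_congr rfl fun η _ => FellBundle.mul_add _ _ _ _

/-- Bilinearity in the form `ab - a'b' = (a - a')b + a'(b - b')`, followed by the uniform bound. The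
value of `j(a * b)` at `γ` obeys the same estimate. -/
theorem norm_partialConv_sub_le (γ : G) (F : Finset {η : G // r η = r γ})
    (a b a' b' : ReducedAlg B) : ‖partialConv γ F a b - partialConv γ F a' b'‖ ≤
      ‖a - a'‖ * ‖b‖ + ‖a'‖ * ‖b - b'‖ := by
  have h1 := partialConv_add_left γ F (a - a') a' b
  have h2 := partialConv_add_right γ F a' (b - b') b'
  rw [sub_add_cancel] at h1 h2
  rw [h1, h2, ← add_assoc, add_sub_cancel_right]
  exact (norm_add_le _ _).trans
    (add_le_add (norm_partialConv_le γ F _ _) (norm_partialConv_le γ F _ _))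

theorem norm_toC0_mul_sub_le (γ : G) (a b a' b' : ReducedAlg B) :
    ‖toC0 (a' * b') γ - toC0 (a * b) γ‖ ≤ ‖a - a'‖ * ‖b‖ + ‖a'‖ * ‖b - b'‖ := by
  rw [norm_sub_rev]
  have h1 : toC0 (a * b) γ - toC0 (a' * b') γ = toC0 ((a - a') * b + a' * (b - b')) γ := by
    rw [sub_mul, mul_sub, sub_add_sub_cancel, map_sub]
    rfl
  rw [h1]
  exact ((C0Section.norm_apply_le _ γ).trans (norm_toC0_le _)).trans
    ((norm_add_le _ _).trans (add_le_add (norm_mul_le _ _) (norm_mul_le _ _)))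

/-- The compact support of `f` meets the range fibre of `γ` in a finite set, beyond which no further
terms contribute. -/
theorem eventually_partialConv_coe (γ : G) (f g : CcSection B) :
    ∀ᶠ F in atTop, partialConv γ F (f : ReducedAlg B) g = toC0 ((f : ReducedAlg B) * (g : ReducedAlg B)) γ := by
  obtain ⟨K, hK, hf⟩ := f.exists_compact
  have hfin : {η : {η : G // r η = r γ} | η.1 ∈ K}.Finite :=
    Set.Finite.of_finite_image ((finite_fibre_r hK (r γ)).subset (by
      rintro _ ⟨η, hη, rfl⟩; exact ⟨hη, η.2⟩)) Subtype.val_injective.injOn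
  filter_upwards [eventually_ge_atTop hfin.toFinset] with F hF
  rw [coe_mul', toC0_coe, partialConv, toC0_coe, toC0_coe]
  refine (finsum_eq_sum_of_support_subset _ fun η hη => hF ?_).symm
  rw [Set.Finite.mem_toFinset]
  by_contra hc
  exact hη (mul_of_left_eq_zero _ (hf _ hc) _)

/-- Replacing `(a, b)` by a nearby pair from Γ_c changes every partial sum, uniformly in the finite
set, and also the proposed limit, by less than `ε/2`. For the nearby pair the partial sums are
eventually equal to the limit. -/
theorem hasSum_toC0_mul (a b : ReducedAlg B) (γ : G) :
    HasSum (fun η : {η : G // r η = r γ} =>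
      mul (isProd_left η.2) (toC0 a η.1) (toC0 b (η.1⁻¹ * γ))) (toC0 (a * b) γ) := by
  rw [HasSum, SummationFilter.unconditional_filter, Metric.tendsto_nhds]
  intro ε hε
  -- The common error bound for partial sums and limit. It is continuous in `q` and zero at `q = (a,
  -- b)`, so this open set is nonempty and contains a pair from Γ_c.
  have hopen : IsOpen {q : ReducedAlg B × ReducedAlg B |
      ‖a - q.1‖ * ‖b‖ + ‖q.1‖ * ‖b - q.2‖ < ε / 2} :=
    isOpen_lt (by fun_prop) continuous_const
  obtain ⟨⟨f, g⟩, hfg⟩ := ((Completion.denseRange_coe (α := CcSection B)).prodMap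
    (Completion.denseRange_coe (α := CcSection B))).exists_mem_open hopen
      ⟨(a, b), by simpa using half_pos hε⟩
  filter_upwards [eventually_partialConv_coe γ f g] with F hF
  have h1 := norm_partialConv_sub_le γ F a b f g
  have h2 := norm_toC0_mul_sub_le γ a b f g
  rw [← hF] at h2
  refine (dist_eq_norm _ _).trans_lt ?_
  refine (norm_sub_le_norm_sub_add_norm_sub _ (partialConv γ F (f : ReducedAlg B) g) _).trans_lt ?_
  have h3 : ‖a - f‖ * ‖b‖ + ‖(f : ReducedAlg B)‖ * ‖b - g‖ < ε / 2 := hfg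
  exact (add_le_add h1 h2).trans_lt (by linarith)

end ReducedAlg

end Embedding

end

end Fell

open Fell Fell.ArrowGroupoid TopologicalSpace Bundle in
theorem theorem1 {G : Type*} [ArrowGroupoid G] [TopologicalSpace G] [IsEtale G]
    [T2Space G] [LocallyCompactSpace G] [SecondCountableTopology G]
    (B : G → Type*) [∀ γ, NormedAddCommGroup (B γ)] [∀ γ, NormedSpace ℂ (B γ)]
    [TopologicalSpace (TotalSpace Unit B)] [FellBundle B]
    (hsep : SeparableSpace (C0Section B)) (hsat : IsSaturated B) :
    ∃ j : ReducedAlg B →ₗ[ℂ] C0Section B,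
      Function.Injective j ∧
      (∀ a : ReducedAlg B, ‖j a‖ ≤ ‖a‖) ∧
      (∀ (f : CcSection B) (γ : G), j (f : ReducedAlg B) γ = f γ) ∧
      (∀ (a : ReducedAlg B) (γ : G),
        j (star a) γ = FellBundle.adj (inv_inv' γ).symm (j a γ⁻¹)) ∧
      (∀ (a b : ReducedAlg B) (γ : G),
        HasSum (fun η : {η : G // r η = r γ} =>
            FellBundle.mul (isProd_left η.2) (j a η.1) (j b (η.1⁻¹ * γ)))
          (j (a * b) γ)) := by
  refine ⟨ReducedAlg.toC0.toLinearMap, ReducedAlg.toC0_injective, ReducedAlg.norm_toC0_le,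
    fun f γ => ?_, ReducedAlg.toC0_star, ReducedAlg.hasSum_toC0_mul⟩
  change ReducedAlg.toC0 (f : ReducedAlg B) γ = f γ
  rw [ReducedAlg.toC0_coe]
  rfl
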